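/- Let $\mathbb{T}^1=\mathbb{R}/2\pi\mathbb{Z}$, and identify functions on $\mathbb{T}^1\times\mathbb{R}$ with functions of $(t,x)\in\mathbb{R}^2$ that are $2\pi$-periodic in $t$. Let $\mathcal{S}(\mathbb{T}^1\times\mathbb{R})$ be the space of smooth functions $f:\mathbb{T}^1\times\mathbb{R}\to\mathbb{C}$ such that $$\|f\|_{\alpha,\beta,\gamma}=\sup_{(t,x)}\left|x^\gamma\partial_t^\alpha\partial_x^\beta f(t,x)\right|<\infty\quad\text{for all }\alpha,\beta,\gamma\in\mathbb{N}_0,$$ and let $\mathcal{S}'(\mathbb{T}^1\times\mathbb{R})$ be the space of linear functionals $u:\mathcal{S}(\mathbb{T}^1\times\mathbb{R})\to\mathbb{C}$ for which there are $N\in\mathbb{N}_0$ and $C>0$ with $|\langle u,f\rangle|\le C\sum_{\alpha+\beta+\gamma\le N}\|f\|_{\alpha,\beta,\gamma}$ for all $f$. Derivatives on $\mathcal{S}'$ are defined by $\langle\partial_t u,f\rangle=-\langle u,\partial_t f\rangle$ and $\langle\partial_x u,f\rangle=-\langle u,\partial_x f\rangle$, and $g\in\mathcal{S}$ is identified with the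 element $\varphi\mapsto\int_{\mathbb{T}^1\times\mathbb{R}}g\varphi\,dt\,dx$ of $\mathcal{S}'$. A differential operator $L:\mathcal{S}'\to\mathcal{S}'$ is called globally hypoelliptic if $u\in\mathcal{S}'$ and $Lu\in\mathcal{S}$ imply $u\in\mathcal{S}$. Let $a,b\in\mathbb{R}$ and $q\in\mathbb{C}$. 1. The operator $L=\partial_t+(a+ib)\partial_x+q$ is globally hypoelliptic if and only if one of the following holds: - $b\neq0$ and $a\frac{\operatorname{Re}(q)}{b}+\operatorname{Im}(q)\notin\mathbb{Z}$; - $b=0$ and $\operatorname{Re}(q)\neq0$; - $a=b=\operatorname{Re}(q)=0$ and $\operatorname{Im}(q)\notin\mathbb{Z}$. 2. The operator $\tilde L=(a+ib)\partial_t+\partial_x+q$ is globally hypoelliptic if and only if one of the following holds: - $b\neq0$ and $\frac{\operatorname{Re}(q)}{b}\notin\mathbb{Z}$; - $b=0$ and $\operatorname{Re}(q)\neq0$. -/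

import Mathlib

open scoped ContDiff

noncomputable section

namespace CylinderSGH

/-! Functions on `𝕋¹ × ℝ`, where `𝕋¹ = ℝ / 2πℤ`, are identified with functions of
`(t, x) ∈ ℝ × ℝ` that are `2π`-periodic in `t`. -/

/-- The classical partial derivative `∂f/∂t` of `f(t, x)`. -/
def pdT (f : ℝ × ℝ → ℂ) : ℝ × ℝ → ℂ := fun p => deriv (fun s : ℝ => f (s, p.2)) p.1

/-- The classical partial derivative `∂f/∂x` of `f(t, x)`. -/
def pdX (f : ℝ × ℝ → ℂ) : ℝ × ℝ → ℂ := fun p => deriv (fun y : ℝ => f (p.1, y)) p.2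

/-- The weighted derivative `|x ^ γ ∂ₜ^α ∂ₓ^β f (t, x)|` at the point `p = (t, x)`. -/
def weighted (α β γ : ℕ) (f : ℝ × ℝ → ℂ) (p : ℝ × ℝ) : ℝ :=
  |p.2| ^ γ * ‖(pdT^[α] (pdX^[β] f)) p‖

/-- `‖f‖_{α,β,γ} = sup_{(t,x)} |x ^ γ ∂ₜ^α ∂ₓ^β f (t, x)|`. -/
def semi (α β γ : ℕ) (f : ℝ × ℝ → ℂ) : ℝ := ⨆ p : ℝ × ℝ, weighted α β γ f p

/-- The triples `(α, β, γ)` of natural numbers with `α + β + γ ≤ N`. -/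
def indices (N : ℕ) : Finset (ℕ × ℕ × ℕ) :=
  (Finset.range (N + 1) ×ˢ Finset.range (N + 1) ×ˢ Finset.range (N + 1)).filter
    (fun i => i.1 + i.2.1 + i.2.2 ≤ N)

/-- `p_N(f) = ∑_{α + β + γ ≤ N} ‖f‖_{α,β,γ}`. -/
def pNorm (N : ℕ) (f : ℝ × ℝ → ℂ) : ℝ := ∑ i ∈ indices N, semi i.1 i.2.1 i.2.2 f

theorem hasDerivAt_fst {f : ℝ × ℝ → ℂ} (hf : ContDiff ℝ ∞ f) (p : ℝ × ℝ) :
    HasDerivAt (fun s : ℝ => f (s, p.2)) (fderiv ℝ f p (1, 0)) p.1 := by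
  have h1 : HasFDerivAt f (fderiv ℝ f p) (p.1, p.2) :=
    (hf.differentiable (by simp) p).hasFDerivAt
  have h2 : HasDerivAt (fun s : ℝ => (s, p.2)) ((1 : ℝ), (0 : ℝ)) p.1 :=
    (hasDerivAt_id p.1).prodMk (hasDerivAt_const p.1 p.2)
  exact h1.comp_hasDerivAt p.1 h2

theorem hasDerivAt_snd {f : ℝ × ℝ → ℂ} (hf : ContDiff ℝ ∞ f) (p : ℝ × ℝ) :
    HasDerivAt (fun y : ℝ => f (p.1, y)) (fderiv ℝ f p (0, 1)) p.2 := by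
  have h1 : HasFDerivAt f (fderiv ℝ f p) (p.1, p.2) :=
    (hf.differentiable (by simp) p).hasFDerivAt
  have h2 : HasDerivAt (fun y : ℝ => (p.1, y)) ((0 : ℝ), (1 : ℝ)) p.2 :=
    (hasDerivAt_const p.2 p.1).prodMk (hasDerivAt_id p.2)
  exact h1.comp_hasDerivAt p.2 h2

theorem pdT_eq {f : ℝ × ℝ → ℂ} (hf : ContDiff ℝ ∞ f) :
    pdT f = fun p => fderiv ℝ f p (1, 0) :=
  funext fun p => (hasDerivAt_fst hf p).deriv

theorem pdX_eq {f : ℝ × ℝ → ℂ} (hf : ContDiff ℝ ∞ f) :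
    pdX f = fun p => fderiv ℝ f p (0, 1) :=
  funext fun p => (hasDerivAt_snd hf p).deriv

theorem contDiff_pdT {f : ℝ × ℝ → ℂ} (hf : ContDiff ℝ ∞ f) : ContDiff ℝ ∞ (pdT f) := by
  rw [pdT_eq hf]
  exact (hf.fderiv_right (m := ∞) (by simp)).clm_apply contDiff_const

theorem contDiff_pdX {f : ℝ × ℝ → ℂ} (hf : ContDiff ℝ ∞ f) : ContDiff ℝ ∞ (pdX f) := by
  rw [pdX_eq hf]
  exact (hf.fderiv_right (m := ∞) (by simp)).clm_apply contDiff_const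

theorem pdT_add {f g : ℝ × ℝ → ℂ} (hf : ContDiff ℝ ∞ f) (hg : ContDiff ℝ ∞ g) :
    pdT (f + g) = pdT f + pdT g :=
  funext fun p => ((hasDerivAt_fst hf p).add (hasDerivAt_fst hg p)).deriv.trans
    (by rw [pdT_eq hf, pdT_eq hg]; rfl)

theorem pdX_add {f g : ℝ × ℝ → ℂ} (hf : ContDiff ℝ ∞ f) (hg : ContDiff ℝ ∞ g) :
    pdX (f + g) = pdX f + pdX g :=
  funext fun p => ((hasDerivAt_snd hf p).add (hasDerivAt_snd hg p)).deriv.trans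
    (by rw [pdX_eq hf, pdX_eq hg]; rfl)

theorem pdT_smul (c : ℂ) {f : ℝ × ℝ → ℂ} (hf : ContDiff ℝ ∞ f) :
    pdT (c • f) = c • pdT f :=
  funext fun p => ((hasDerivAt_fst hf p).const_smul c).deriv.trans
    (by rw [pdT_eq hf]; rfl)

theorem pdX_smul (c : ℂ) {f : ℝ × ℝ → ℂ} (hf : ContDiff ℝ ∞ f) :
    pdX (c • f) = c • pdX f :=
  funext fun p => ((hasDerivAt_snd hf p).const_smul c).deriv.trans
    (by rw [pdX_eq hf]; rfl)

theorem pdT_pdX_comm {f : ℝ × ℝ → ℂ} (hf : ContDiff ℝ ∞ f) :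
    pdX (pdT f) = pdT (pdX f) := by
  have hd : Differentiable ℝ (fderiv ℝ f) :=
    (hf.fderiv_right (m := ∞) (by simp)).differentiable (by simp)
  rw [pdX_eq (contDiff_pdT hf), pdT_eq (contDiff_pdX hf), pdT_eq hf, pdX_eq hf]
  funext p
  have hs : IsSymmSndFDerivAt ℝ f p := (hf.contDiffAt).isSymmSndFDerivAt
    (by simp only [minSmoothness_of_isRCLikeNormedField]; exact WithTop.coe_le_coe.2 le_top)
  have key : ∀ v w : ℝ × ℝ,
      fderiv ℝ (fun p => fderiv ℝ f p v) p w = fderiv ℝ (fderiv ℝ f) p w v := by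
    intro v w
    rw [((hd p).hasFDerivAt.clm_apply (hasFDerivAt_const v p)).fderiv]
    simp
  change fderiv ℝ (fun p => fderiv ℝ f p (1, 0)) p (0, 1)
    = fderiv ℝ (fun p => fderiv ℝ f p (0, 1)) p (1, 0)
  rw [key, key]
  exact hs.eq (0, 1) (1, 0)

theorem contDiff_iter_pdX {f : ℝ × ℝ → ℂ} (hf : ContDiff ℝ ∞ f) (n : ℕ) :
    ContDiff ℝ ∞ (pdX^[n] f) := by
  induction n with
  | zero => exact hf
  | succ n ih => rw [Function.iterate_succ_apply']; exact contDiff_pdX ih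

theorem contDiff_iter_pdT {f : ℝ × ℝ → ℂ} (hf : ContDiff ℝ ∞ f) (n : ℕ) :
    ContDiff ℝ ∞ (pdT^[n] f) := by
  induction n with
  | zero => exact hf
  | succ n ih => rw [Function.iterate_succ_apply']; exact contDiff_pdT ih

theorem iter_pdX_pdT {f : ℝ × ℝ → ℂ} (hf : ContDiff ℝ ∞ f) (n : ℕ) :
    pdX^[n] (pdT f) = pdT (pdX^[n] f) := by
  induction n with
  | zero => rfl
  | succ n ih =>
    rw [Function.iterate_succ_apply', ih, pdT_pdX_comm (contDiff_iter_pdX hf n),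
      Function.iterate_succ_apply']

theorem iter_pdX_add {f g : ℝ × ℝ → ℂ} (hf : ContDiff ℝ ∞ f) (hg : ContDiff ℝ ∞ g) (n : ℕ) :
    pdX^[n] (f + g) = pdX^[n] f + pdX^[n] g := by
  induction n with
  | zero => rfl
  | succ n ih =>
    simp only [Function.iterate_succ_apply', ih]
    exact pdX_add (contDiff_iter_pdX hf n) (contDiff_iter_pdX hg n)

theorem iter_pdT_add {f g : ℝ × ℝ → ℂ} (hf : ContDiff ℝ ∞ f) (hg : ContDiff ℝ ∞ g) (n : ℕ) :
    pdT^[n] (f + g) = pdT^[n] f + pdT^[n] g := by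
  induction n with
  | zero => rfl
  | succ n ih =>
    simp only [Function.iterate_succ_apply', ih]
    exact pdT_add (contDiff_iter_pdT hf n) (contDiff_iter_pdT hg n)

theorem iter_pdX_smul (c : ℂ) {f : ℝ × ℝ → ℂ} (hf : ContDiff ℝ ∞ f) (n : ℕ) :
    pdX^[n] (c • f) = c • pdX^[n] f := by
  induction n with
  | zero => rfl
  | succ n ih =>
    simp only [Function.iterate_succ_apply', ih]
    exact pdX_smul c (contDiff_iter_pdX hf n)

theorem iter_pdT_smul (c : ℂ) {f : ℝ × ℝ → ℂ} (hf : ContDiff ℝ ∞ f) (n : ℕ) :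
    pdT^[n] (c • f) = c • pdT^[n] f := by
  induction n with
  | zero => rfl
  | succ n ih =>
    simp only [Function.iterate_succ_apply', ih]
    exact pdT_smul c (contDiff_iter_pdT hf n)

theorem weighted_nonneg (α β γ : ℕ) (f : ℝ × ℝ → ℂ) (p : ℝ × ℝ) : 0 ≤ weighted α β γ f p := by
  unfold weighted; positivity

theorem semi_nonneg (α β γ : ℕ) (f : ℝ × ℝ → ℂ) : 0 ≤ semi α β γ f :=
  Real.iSup_nonneg fun p => weighted_nonneg α β γ f p

theorem weighted_add_le {f g : ℝ × ℝ → ℂ} (hf : ContDiff ℝ ∞ f) (hg : ContDiff ℝ ∞ g)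
    (α β γ : ℕ) (p : ℝ × ℝ) :
    weighted α β γ (f + g) p ≤ weighted α β γ f p + weighted α β γ g p := by
  unfold weighted
  rw [iter_pdX_add hf hg, iter_pdT_add (contDiff_iter_pdX hf β) (contDiff_iter_pdX hg β),
    ← mul_add]
  exact mul_le_mul_of_nonneg_left (norm_add_le _ _) (by positivity)

theorem weighted_smul (c : ℂ) {f : ℝ × ℝ → ℂ} (hf : ContDiff ℝ ∞ f) (α β γ : ℕ) (p : ℝ × ℝ) :
    weighted α β γ (c • f) p = ‖c‖ * weighted α β γ f p := by
  unfold weighted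
  rw [iter_pdX_smul c hf, iter_pdT_smul c (contDiff_iter_pdX hf β), Pi.smul_apply, norm_smul]
  ring

theorem weighted_pdT {f : ℝ × ℝ → ℂ} (hf : ContDiff ℝ ∞ f) (α β γ : ℕ) :
    weighted α β γ (pdT f) = weighted (α + 1) β γ f := by
  funext p
  unfold weighted
  rw [iter_pdX_pdT hf, Function.iterate_succ_apply]

theorem weighted_pdX (f : ℝ × ℝ → ℂ) (α β γ : ℕ) :
    weighted α β γ (pdX f) = weighted α (β + 1) γ f := rfl

/-- The space `𝒮(𝕋¹ × ℝ)`: smooth functions, `2π`-periodic in `t`, all of whose seminorms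
`‖f‖_{α,β,γ}` are finite. -/
def Schwartz : Submodule ℂ (ℝ × ℝ → ℂ) where
  carrier := {f | ContDiff ℝ ∞ f ∧ (∀ t x : ℝ, f (t + 2 * Real.pi, x) = f (t, x)) ∧
    ∀ α β γ : ℕ, BddAbove (Set.range (weighted α β γ f))}
  zero_mem' := by
    refine ⟨contDiff_const, fun _ _ => rfl, fun α β γ => ⟨0, ?_⟩⟩
    rintro _ ⟨p, rfl⟩
    have h := weighted_smul 0 (f := 0) contDiff_const α β γ p
    rw [zero_smul] at h
    exact (h.trans (by rw [norm_zero, zero_mul])).le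
  add_mem' := by
    rintro f g ⟨hf, pf, bf⟩ ⟨hg, pg, bg⟩
    refine ⟨hf.add hg, fun t x => ?_, fun α β γ => ?_⟩
    · simp [pf, pg]
    · obtain ⟨A, hA⟩ := bf α β γ
      obtain ⟨B, hB⟩ := bg α β γ
      refine ⟨A + B, ?_⟩
      rintro _ ⟨p, rfl⟩
      exact (weighted_add_le hf hg α β γ p).trans (add_le_add (hA ⟨p, rfl⟩) (hB ⟨p, rfl⟩))
  smul_mem' := by
    rintro c f ⟨hf, pf, bf⟩
    refine ⟨contDiff_const.smul hf, fun t x => ?_, fun α β γ => ?_⟩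
    · simp [pf]
    · obtain ⟨A, hA⟩ := bf α β γ
      refine ⟨‖c‖ * A, ?_⟩
      rintro _ ⟨p, rfl⟩
      rw [weighted_smul c hf]
      exact mul_le_mul_of_nonneg_left (hA ⟨p, rfl⟩) (norm_nonneg c)

/-- `∂ₜ` as a linear operator on `𝒮(𝕋¹ × ℝ)`. -/
def Schwartz.dT : Schwartz →ₗ[ℂ] Schwartz where
  toFun f := ⟨pdT f.1, contDiff_pdT f.2.1, fun t x => by
      have h : (fun s : ℝ => f.1 (s + 2 * Real.pi, x)) = fun s => f.1 (s, x) :=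
        funext fun s => f.2.2.1 s x
      change deriv (fun s : ℝ => f.1 (s, x)) (t + 2 * Real.pi)
        = deriv (fun s : ℝ => f.1 (s, x)) t
      rw [← deriv_comp_add_const (fun s : ℝ => f.1 (s, x)) (2 * Real.pi) t, h],
    fun α β γ => by rw [weighted_pdT f.2.1]; exact f.2.2.2 _ _ _⟩
  map_add' f g := Subtype.ext (pdT_add f.2.1 g.2.1)
  map_smul' c f := Subtype.ext (pdT_smul c f.2.1)

/-- `∂ₓ` as a linear operator on `𝒮(𝕋¹ × ℝ)`. -/
def Schwartz.dX : Schwartz →ₗ[ℂ] Schwartz where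
  toFun f := ⟨pdX f.1, contDiff_pdX f.2.1, fun t x => by
      change deriv (fun y : ℝ => f.1 (t + 2 * Real.pi, y)) x
        = deriv (fun y : ℝ => f.1 (t, y)) x
      simp only [f.2.2.1],
    fun α β γ => by rw [weighted_pdX]; exact f.2.2.2 _ _ _⟩
  map_add' f g := Subtype.ext (pdX_add f.2.1 g.2.1)
  map_smul' c f := Subtype.ext (pdX_smul c f.2.1)

theorem pNorm_nonneg (N : ℕ) (f : ℝ × ℝ → ℂ) : 0 ≤ pNorm N f :=
  Finset.sum_nonneg fun i _ => semi_nonneg i.1 i.2.1 i.2.2 f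

theorem pNorm_mono {M N : ℕ} (h : M ≤ N) (f : ℝ × ℝ → ℂ) : pNorm M f ≤ pNorm N f := by
  refine Finset.sum_le_sum_of_subset_of_nonneg (fun i hi => ?_)
    fun i _ _ => semi_nonneg i.1 i.2.1 i.2.2 f
  simp only [indices, Finset.mem_filter, Finset.mem_product, Finset.mem_range] at hi ⊢
  omega

theorem pNorm_dT_le (N : ℕ) (f : Schwartz) :
    pNorm N (Schwartz.dT f).1 ≤ pNorm (N + 1) f.1 := by
  have h : pNorm N (Schwartz.dT f).1
      = ∑ i ∈ (indices N).image (fun i => (i.1 + 1, i.2.1, i.2.2)),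
          semi i.1 i.2.1 i.2.2 f.1 := by
    rw [Finset.sum_image (by rintro ⟨a, b, c⟩ _ ⟨a', b', c'⟩ _ h; simpa using h)]
    exact Finset.sum_congr rfl fun i _ => by
      unfold semi; exact congrArg iSup (weighted_pdT f.2.1 i.1 i.2.1 i.2.2)
  rw [h]
  refine Finset.sum_le_sum_of_subset_of_nonneg (fun i hi => ?_)
    fun i _ _ => semi_nonneg i.1 i.2.1 i.2.2 f.1
  obtain ⟨j, hj, rfl⟩ := Finset.mem_image.1 hi
  simp only [indices, Finset.mem_filter, Finset.mem_product, Finset.mem_range] at hj ⊢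
  omega

theorem pNorm_dX_le (N : ℕ) (f : Schwartz) :
    pNorm N (Schwartz.dX f).1 ≤ pNorm (N + 1) f.1 := by
  have h : pNorm N (Schwartz.dX f).1
      = ∑ i ∈ (indices N).image (fun i => (i.1, i.2.1 + 1, i.2.2)),
          semi i.1 i.2.1 i.2.2 f.1 := by
    rw [Finset.sum_image (by rintro ⟨a, b, c⟩ _ ⟨a', b', c'⟩ _ h; simpa using h)]
    exact Finset.sum_congr rfl fun i _ => rfl
  rw [h]
  refine Finset.sum_le_sum_of_subset_of_nonneg (fun i hi => ?_)
    fun i _ _ => semi_nonneg i.1 i.2.1 i.2.2 f.1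
  obtain ⟨j, hj, rfl⟩ := Finset.mem_image.1 hi
  simp only [indices, Finset.mem_filter, Finset.mem_product, Finset.mem_range] at hj ⊢
  omega

/-- The space `𝒮'(𝕋¹ × ℝ)`: linear functionals `u` on `𝒮(𝕋¹ × ℝ)` with
`|⟨u, f⟩| ≤ C p_N(f)` for some `C`, `N` and all `f`. -/
def Distr : Submodule ℂ (Schwartz →ₗ[ℂ] ℂ) where
  carrier := {u | ∃ (N : ℕ) (C : ℝ), 0 < C ∧ ∀ f : Schwartz, ‖u f‖ ≤ C * pNorm N f.1}
  zero_mem' := ⟨0, 1, one_pos, fun f => by simpa using pNorm_nonneg 0 f.1⟩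
  add_mem' := by
    rintro u v ⟨M, A, hA, hu⟩ ⟨N, B, hB, hv⟩
    refine ⟨max M N, A + B, add_pos hA hB, fun f => ?_⟩
    calc ‖u f + v f‖ ≤ ‖u f‖ + ‖v f‖ := norm_add_le _ _
      _ ≤ A * pNorm M f.1 + B * pNorm N f.1 := add_le_add (hu f) (hv f)
      _ ≤ A * pNorm (max M N) f.1 + B * pNorm (max M N) f.1 :=
          add_le_add (mul_le_mul_of_nonneg_left (pNorm_mono (le_max_left _ _) _) hA.le)
            (mul_le_mul_of_nonneg_left (pNorm_mono (le_max_right _ _) _) hB.le)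
      _ = (A + B) * pNorm (max M N) f.1 := by ring
  smul_mem' := by
    rintro c u ⟨M, A, hA, hu⟩
    refine ⟨M, (‖c‖ + 1) * A, by positivity, fun f => ?_⟩
    calc ‖c • u f‖ = ‖c‖ * ‖u f‖ := norm_smul _ _
      _ ≤ (‖c‖ + 1) * (A * pNorm M f.1) :=
          mul_le_mul (by linarith) (hu f) (norm_nonneg _) (by positivity)
      _ = (‖c‖ + 1) * A * pNorm M f.1 := by ring

/-- `∂ₜ` on `𝒮'(𝕋¹ × ℝ)`: `⟨∂ₜ u, f⟩ = -⟨u, ∂ₜ f⟩`. -/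
def dT : Distr →ₗ[ℂ] Distr where
  toFun u := ⟨-(u.1 ∘ₗ Schwartz.dT), by
    obtain ⟨N, C, hC, h⟩ := u.2
    refine ⟨N + 1, C, hC, fun f => ?_⟩
    rw [LinearMap.neg_apply, norm_neg]
    exact (h _).trans (mul_le_mul_of_nonneg_left (pNorm_dT_le N f) hC.le)⟩
  map_add' u v := Subtype.ext (LinearMap.ext fun f => neg_add (u.1 _) (v.1 _))
  map_smul' c u := Subtype.ext (LinearMap.ext fun f => (smul_neg c (u.1 _)).symm)

/-- `∂ₓ` on `𝒮'(𝕋¹ × ℝ)`: `⟨∂ₓ u, f⟩ = -⟨u, ∂ₓ f⟩`. -/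
def dX : Distr →ₗ[ℂ] Distr where
  toFun u := ⟨-(u.1 ∘ₗ Schwartz.dX), by
    obtain ⟨N, C, hC, h⟩ := u.2
    refine ⟨N + 1, C, hC, fun f => ?_⟩
    rw [LinearMap.neg_apply, norm_neg]
    exact (h _).trans (mul_le_mul_of_nonneg_left (pNorm_dX_le N f) hC.le)⟩
  map_add' u v := Subtype.ext (LinearMap.ext fun f => neg_add (u.1 _) (v.1 _))
  map_smul' c u := Subtype.ext (LinearMap.ext fun f => (smul_neg c (u.1 _)).symm)

/-- The distribution `u` belongs to `𝒮(𝕋¹ × ℝ)`, i.e. it is the distribution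
`φ ↦ ∫_{𝕋¹ × ℝ} g(t, x) φ(t, x) dt dx` for some `g ∈ 𝒮(𝕋¹ × ℝ)`. -/
def IsSchwartz (u : Distr) : Prop :=
  ∃ g : Schwartz, ∀ φ : Schwartz,
    u.1 φ = ∫ p in Set.Ioc (0 : ℝ) (2 * Real.pi) ×ˢ (Set.univ : Set ℝ), g.1 p * φ.1 p

/-- `L` is (Schwartz) globally hypoelliptic: `u ∈ 𝒮'` and `L u ∈ 𝒮` imply `u ∈ 𝒮`. -/
def GloballyHypoelliptic (L : Distr →ₗ[ℂ] Distr) : Prop :=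
  ∀ u : Distr, IsSchwartz (L u) → IsSchwartz u

end CylinderSGH

end

noncomputable section

namespace CylinderSGH

open MeasureTheory
open Complex (I exp)
open scoped SchwartzMap

/-! On `e^{i(kt+ξx)}`, with `k ∈ ℤ` and `ξ ∈ ℝ`, the operator `c₁∂ₜ + c₂∂ₓ + q` multiplies by the
symbol `i c₁ k + i c₂ ξ + q`. Both operators of the theorem are globally hypoelliptic exactly when
their symbol has no zero, and the listed conditions spell this out.

A zero of the symbol yields a plane wave in the kernel, and a plane wave is not in `𝒮`
(`not_isSchwartz_planeDistr`).

Without zeros, the operator and its transpose both map `𝒮` onto `𝒮`. This suffices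
(`globallyHypoelliptic_of_surjective`): if `Lu = g = Lf` with `f ∈ 𝒮`, then `u - f` annihilates the
range of the transpose, which is all of `𝒮`, so `u = f`.

Surjectivity comes from a Fourier series in `t`. For `c₂ ≠ 0`, mode `k` is the equation `f' + r_k f
= g_k / c₂` with `r_k = (i c₁ k + q) / c₂`. The absence of zeros means `Re r_k ≠ 0`, so convolution
with an exponential on a half-line solves it. Since `Re r_k` is affine in the integer `k`, it is
bounded away from `0` (`exists_pos_le_abs_affine`); no small divisors occur, the estimates are
uniform in `k`, and the modes sum to an element of `𝒮`. For `c₂ = 0` each mode is simply divided by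
the symbol. -/

/-! ### Summing Fourier modes in `t` to a Schwartz function. -/

/-- The summable weight `(1 + k²)⁻¹` on the integers. -/
def modeWeight (k : ℤ) : ℝ := (1 + (k : ℝ) ^ 2)⁻¹

theorem modeWeight_pos (k : ℤ) : 0 < modeWeight k := by unfold modeWeight; positivity

theorem summable_modeWeight : Summable modeWeight := by
  -- The shift by `1/2` keeps the comparison series `∑ (k + 1/2)⁻²` free of a singular term at `k =
  -- 0`.
  have h := (Real.summable_one_div_int_add_rpow (1 / 2) 2).2 (by norm_num)
  refine Summable.of_nonneg_of_le (fun k => (modeWeight_pos k).le) (fun k => ?_) (h.mul_left 2)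
  have hk : ((k : ℝ) + 1 / 2) ≠ 0 := by
    intro h0
    have h1 : (2 * k + 1 : ℝ) = 0 := by linarith
    have h2 : 2 * k + 1 = 0 := by exact_mod_cast h1
    omega
  have hpos : 0 < ((k : ℝ) + 1 / 2) ^ 2 := by positivity
  rw [Real.rpow_two, sq_abs, modeWeight, mul_one_div, inv_le_iff_one_le_mul₀ (by positivity),
    div_mul_eq_mul_div, le_div_iff₀ hpos]
  nlinarith [sq_nonneg ((k : ℝ) - 1 / 2)]

/-- A family of operators `g ↦ T k g`, from `𝒮(𝕋¹ × ℝ)` to functions on `ℝ`, which behave like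
`g ↦ m_k (g_k)` for the Fourier coefficients `g_k` in `t` and translation invariant
operators `m_k` bounded uniformly in `k`. -/
structure IsModeFamily (T : ℤ → Schwartz → ℝ → ℂ) : Prop where
  hasDerivAt : ∀ k g x, HasDerivAt (T k g) (T k (Schwartz.dX g) x) x
  map_dT : ∀ k g x, T k (Schwartz.dT g) x = I * k * T k g x
  bound : ∀ g γ, ∃ C, ∀ k x, |x| ^ γ * ‖T k g x‖ ≤ C

/-- The function `(t, x) ↦ ∑ₖ e^{ikt} T_k g (x)`. -/
def synth (T : ℤ → Schwartz → ℝ → ℂ) (g : Schwartz) (p : ℝ × ℝ) : ℂ :=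
  ∑' k : ℤ, exp (I * k * p.1) * T k g p.2

theorem norm_exp_mode (k : ℤ) (t : ℝ) : ‖exp (I * k * t)‖ = 1 := by
  rw [Complex.norm_exp]; simp

theorem hasDerivAt_exp_mode (k : ℤ) (t : ℝ) :
    HasDerivAt (fun t : ℝ => exp (I * k * t)) (I * k * exp (I * k * t)) t := by
  have h : HasDerivAt (fun t : ℝ => I * k * (t : ℂ)) (I * k) t := by
    simpa using (Complex.ofRealCLM.hasDerivAt (x := t)).const_mul (I * (k : ℂ))
  simpa [mul_comm] using h.cexp

namespace IsModeFamily

variable {T : ℤ → Schwartz → ℝ → ℂ} (hT : IsModeFamily T)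
include hT

/-- Two `t`-derivatives of `g` cost a factor `k²` on mode `k`, so the uniform bounds for `g` and
`∂ₜ²g` add up to a bound on `(1 + k²)‖T k g x‖`. -/
theorem decay (g : Schwartz) (γ : ℕ) :
    ∃ C, ∀ k x, |x| ^ γ * ‖T k g x‖ ≤ C * modeWeight k := by
  obtain ⟨A, hA⟩ := hT.bound g γ
  obtain ⟨B, hB⟩ := hT.bound (Schwartz.dT (Schwartz.dT g)) γ
  refine ⟨A + B, fun k x => ?_⟩
  have hb := hB k x
  rw [hT.map_dT, hT.map_dT, ← mul_assoc, norm_mul] at hb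
  have hn : ‖I * (k : ℂ) * (I * k)‖ = (k : ℝ) ^ 2 := by
    simp [← sq]
  rw [hn] at hb
  rw [modeWeight, ← div_eq_mul_inv, le_div_iff₀ (by positivity)]
  nlinarith [hA k x]

theorem norm_le (g : Schwartz) : ∃ C, ∀ (k : ℤ) (p : ℝ × ℝ),
    ‖exp (I * k * p.1) * T k g p.2‖ ≤ C * modeWeight k := by
  obtain ⟨C, hC⟩ := hT.decay g 0
  refine ⟨C, fun k p => ?_⟩
  rw [norm_mul, norm_exp_mode]
  simpa using hC k p.2

theorem summable (g : Schwartz) (p : ℝ × ℝ) :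
    Summable fun k : ℤ => exp (I * k * p.1) * T k g p.2 := by
  obtain ⟨C, hC⟩ := hT.norm_le g
  exact Summable.of_norm_bounded (summable_modeWeight.mul_left C) fun k => hC k p

theorem hasFDerivAt_term (k : ℤ) (g : Schwartz) (p : ℝ × ℝ) :
    HasFDerivAt (fun p : ℝ × ℝ => exp (I * k * p.1) * T k g p.2)
      ((ContinuousLinearMap.fst ℝ ℝ ℝ).smulRight
          (exp (I * k * p.1) * T k (Schwartz.dT g) p.2)
        + (ContinuousLinearMap.snd ℝ ℝ ℝ).smulRight
          (exp (I * k * p.1) * T k (Schwartz.dX g) p.2)) p := by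
  have h1 := (hasDerivAt_exp_mode k p.1).hasFDerivAt.comp p
    (hasFDerivAt_fst (𝕜 := ℝ) (E := ℝ) (F := ℝ) (p := p))
  have h2 := (hT.hasDerivAt k g p.2).hasFDerivAt.comp p
    (hasFDerivAt_snd (𝕜 := ℝ) (E := ℝ) (F := ℝ) (p := p))
  have h := h1.mul h2
  refine h.congr_fderiv ?_
  refine ContinuousLinearMap.ext fun v => ?_
  simp [hT.map_dT]
  ring

/-- Termwise differentiation: the differentiated series are the synthesis series of `∂ₜg` and `∂ₓg`,
hence dominated by the same summable weight. -/
theorem hasFDerivAt_synth (g : Schwartz) (p : ℝ × ℝ) :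
    HasFDerivAt (synth T g)
      ((ContinuousLinearMap.fst ℝ ℝ ℝ).smulRight (synth T (Schwartz.dT g) p)
        + (ContinuousLinearMap.snd ℝ ℝ ℝ).smulRight (synth T (Schwartz.dX g) p)) p := by
  obtain ⟨A, hA⟩ := hT.norm_le (Schwartz.dT g)
  obtain ⟨B, hB⟩ := hT.norm_le (Schwartz.dX g)
  have h := hasFDerivAt_tsum (𝕜 := ℝ) (summable_modeWeight.mul_left (A + B))
    (fun k p => hT.hasFDerivAt_term k g p) (fun k p => ?_) (hT.summable g 0) p
  · refine h.congr_fderiv ?_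
    have s1 := (hT.summable (Schwartz.dT g) p).hasSum.mapL
      (ContinuousLinearMap.smulRightL ℝ (ℝ × ℝ) ℂ (ContinuousLinearMap.fst ℝ ℝ ℝ))
    have s2 := (hT.summable (Schwartz.dX g) p).hasSum.mapL
      (ContinuousLinearMap.smulRightL ℝ (ℝ × ℝ) ℂ (ContinuousLinearMap.snd ℝ ℝ ℝ))
    exact (s1.add s2).tsum_eq
  · refine (norm_add_le _ _).trans ?_
    rw [ContinuousLinearMap.norm_smulRight_apply, ContinuousLinearMap.norm_smulRight_apply,
      add_mul]
    refine add_le_add ?_ ?_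
    · refine le_trans ?_ (hA k p)
      exact mul_le_of_le_one_left (norm_nonneg _) (ContinuousLinearMap.norm_fst_le ℝ ℝ ℝ)
    · refine le_trans ?_ (hB k p)
      exact mul_le_of_le_one_left (norm_nonneg _) (ContinuousLinearMap.norm_snd_le ℝ ℝ ℝ)

theorem contDiff_synth (g : Schwartz) : ContDiff ℝ ∞ (synth T g) := by
  rw [contDiff_infty]
  intro n
  -- The derivative of `synth T g` is built from `synth T` of other functions, so the induction must
  -- run over all `g` at once.
  induction n generalizing g with
  | zero =>
    exact contDiff_zero.2 (continuous_iff_continuousAt.2 fun p =>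
      (hT.hasFDerivAt_synth g p).continuousAt)
  | succ n ih =>
    refine contDiff_succ_iff_hasFDerivAt.2 ⟨_, ?_, hT.hasFDerivAt_synth g⟩
    exact (contDiff_const.smulRight (ih _)).add (contDiff_const.smulRight (ih _))

theorem pdT_synth (g : Schwartz) : pdT (synth T g) = synth T (Schwartz.dT g) := by
  rw [pdT_eq (hT.contDiff_synth g)]
  funext p
  rw [(hT.hasFDerivAt_synth g p).fderiv]
  simp

theorem pdX_synth (g : Schwartz) : pdX (synth T g) = synth T (Schwartz.dX g) := by
  rw [pdX_eq (hT.contDiff_synth g)]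
  funext p
  rw [(hT.hasFDerivAt_synth g p).fderiv]
  simp

theorem iter_pdT_synth (n : ℕ) (g : Schwartz) :
    pdT^[n] (synth T g) = synth T (Schwartz.dT^[n] g) := by
  induction n generalizing g with
  | zero => rfl
  | succ n ih => rw [Function.iterate_succ_apply, hT.pdT_synth, ih, Function.iterate_succ_apply]

theorem iter_pdX_synth (n : ℕ) (g : Schwartz) :
    pdX^[n] (synth T g) = synth T (Schwartz.dX^[n] g) := by
  induction n generalizing g with
  | zero => rfl
  | succ n ih => rw [Function.iterate_succ_apply, hT.pdX_synth, ih, Function.iterate_succ_apply]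

theorem bound_synth (g : Schwartz) (γ : ℕ) : ∃ C, ∀ p, |p.2| ^ γ * ‖synth T g p‖ ≤ C := by
  obtain ⟨C, hC⟩ := hT.decay g γ
  refine ⟨∑' k, C * modeWeight k, fun p => ?_⟩
  have hn : ‖((|p.2| ^ γ : ℝ) : ℂ)‖ = |p.2| ^ γ := by
    rw [Complex.norm_real, Real.norm_of_nonneg (by positivity)]
  rw [← hn, ← norm_mul, synth, ← tsum_mul_left]
  refine tsum_of_norm_bounded (summable_modeWeight.mul_left C).hasSum fun k => ?_
  rw [norm_mul, norm_mul, hn, norm_exp_mode, one_mul]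
  exact hC k p.2

theorem synth_mem (g : Schwartz) : synth T g ∈ Schwartz := by
  refine ⟨hT.contDiff_synth g, fun t x => ?_, fun α β γ => ?_⟩
  · refine tsum_congr fun k => ?_
    have : I * k * ((t + 2 * Real.pi : ℝ) : ℂ) = I * k * t + k * (2 * Real.pi * I) := by
      push_cast; ring
    change exp (I * k * ((t + 2 * Real.pi : ℝ) : ℂ)) * _ = _
    rw [this, Complex.exp_add, Complex.exp_int_mul_two_pi_mul_I, mul_one]
  · obtain ⟨C, hC⟩ := hT.bound_synth (Schwartz.dT^[α] (Schwartz.dX^[β] g)) γ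
    refine ⟨C, ?_⟩
    rintro _ ⟨p, rfl⟩
    rw [weighted, hT.iter_pdX_synth, hT.iter_pdT_synth]
    exact hC p

end IsModeFamily

/-! ### Integration by parts on the cylinder. -/

/-- A fundamental domain of `𝕋¹ × ℝ` in `ℝ × ℝ`. -/
abbrev strip : Set (ℝ × ℝ) := Set.Ioc (0 : ℝ) (2 * Real.pi) ×ˢ (Set.univ : Set ℝ)

theorem pow_mul_norm_le_semi (f : Schwartz) (γ : ℕ) (p : ℝ × ℝ) :
    |p.2| ^ γ * ‖f.1 p‖ ≤ semi 0 0 γ f.1 :=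
  le_ciSup (f.2.2.2 0 0 γ) p

theorem norm_le_semi_mul_inv (f : Schwartz) (p : ℝ × ℝ) :
    ‖f.1 p‖ ≤ (semi 0 0 0 f.1 + semi 0 0 2 f.1) * (1 + p.2 ^ 2)⁻¹ := by
  rw [← div_eq_mul_inv, le_div_iff₀ (by positivity)]
  have h0 := pow_mul_norm_le_semi f 0 p
  have h2 := pow_mul_norm_le_semi f 2 p
  rw [sq_abs] at h2
  rw [pow_zero] at h0
  linarith

theorem integrableOn_strip_inv (C : ℝ) :
    IntegrableOn (fun p : ℝ × ℝ => C * (1 + p.2 ^ 2)⁻¹) strip := by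
  rw [IntegrableOn, Measure.volume_eq_prod, ← Measure.prod_restrict, Measure.restrict_univ]
  have h := (integrable_const (μ := (volume : Measure ℝ).restrict
    (Set.Ioc (0 : ℝ) (2 * Real.pi))) C).mul_prod integrable_inv_one_add_sq
  exact h

theorem integrableOn_strip {F : ℝ × ℝ → ℂ} (hF : Continuous F) {C : ℝ}
    (h : ∀ p, ‖F p‖ ≤ C * (1 + p.2 ^ 2)⁻¹) : IntegrableOn F strip :=
  (integrableOn_strip_inv C).mono' hF.aestronglyMeasurable (ae_of_all _ h)

theorem integrable_inv_bound {F : ℝ → ℂ} (hF : Continuous F) {C : ℝ}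
    (h : ∀ x, ‖F x‖ ≤ C * (1 + x ^ 2)⁻¹) : Integrable F :=
  (integrable_inv_one_add_sq.const_mul C).mono' hF.aestronglyMeasurable (ae_of_all _ h)

theorem integral_strip_eq {F : ℝ × ℝ → ℂ} (hF : IntegrableOn F strip) :
    ∫ p in strip, F p = ∫ t in Set.Ioc (0 : ℝ) (2 * Real.pi), ∫ x, F (t, x) := by
  have := setIntegral_prod (μ := volume) (ν := volume) F hF
  rw [Measure.volume_eq_prod, this]
  simp

theorem integral_pdX_eq_zero {F : ℝ × ℝ → ℂ} (hF : ContDiff ℝ ∞ F) {C D : ℝ}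
    (h0 : ∀ p, ‖F p‖ ≤ C * (1 + p.2 ^ 2)⁻¹) (h1 : ∀ p, ‖pdX F p‖ ≤ D * (1 + p.2 ^ 2)⁻¹) :
    ∫ p in strip, pdX F p = 0 := by
  have hc := (contDiff_pdX hF).continuous
  rw [integral_strip_eq (integrableOn_strip hc h1)]
  refine integral_eq_zero_of_ae (ae_of_all _ fun t => ?_)
  have hd : ∀ x, HasDerivAt (fun x => F (t, x)) (pdX F (t, x)) x := fun x =>
    (hasDerivAt_snd hF (t, x)).differentiableAt.hasDerivAt
  exact integral_eq_zero_of_hasDerivAt_of_integrable hd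
    (integrable_inv_bound (hc.comp (by fun_prop)) fun x => h1 (t, x))
    (integrable_inv_bound (hF.continuous.comp (by fun_prop)) fun x => h0 (t, x))

theorem integral_pdT_eq_zero {F : ℝ × ℝ → ℂ} (hF : ContDiff ℝ ∞ F)
    (hper : ∀ t x : ℝ, F (t + 2 * Real.pi, x) = F (t, x)) {D : ℝ}
    (h1 : ∀ p, ‖pdT F p‖ ≤ D * (1 + p.2 ^ 2)⁻¹) :
    ∫ p in strip, pdT F p = 0 := by
  have hc := (contDiff_pdT hF).continuous
  have hint := integrableOn_strip hc h1
  rw [integral_strip_eq hint, integral_integral_swap]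
  · refine integral_eq_zero_of_ae (ae_of_all _ fun x => ?_)
    have hd : ∀ t, HasDerivAt (fun t => F (t, x)) (pdT F (t, x)) t := fun t =>
      (hasDerivAt_fst hF (t, x)).differentiableAt.hasDerivAt
    have h := intervalIntegral.integral_eq_sub_of_hasDerivAt
      (a := 0) (b := 2 * Real.pi) (fun t _ => hd t)
      ((hc.comp (by fun_prop : Continuous fun t : ℝ => (t, x))).intervalIntegrable _ _)
    rw [intervalIntegral.integral_of_le (by positivity)] at h
    have hp := hper 0 x
    rw [zero_add] at hp
    rw [hp, sub_self] at h
    exact h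
  · rw [IntegrableOn, Measure.volume_eq_prod, ← Measure.prod_restrict,
      Measure.restrict_univ] at hint
    exact hint

theorem pdT_mul {f g : ℝ × ℝ → ℂ} (hf : ContDiff ℝ ∞ f) (hg : ContDiff ℝ ∞ g) :
    pdT (f * g) = pdT f * g + f * pdT g := by
  funext p
  exact (((hasDerivAt_fst hf p).differentiableAt.hasDerivAt).mul
    ((hasDerivAt_fst hg p).differentiableAt.hasDerivAt)).deriv

theorem pdX_mul {f g : ℝ × ℝ → ℂ} (hf : ContDiff ℝ ∞ f) (hg : ContDiff ℝ ∞ g) :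
    pdX (f * g) = pdX f * g + f * pdX g := by
  funext p
  exact (((hasDerivAt_snd hf p).differentiableAt.hasDerivAt).mul
    ((hasDerivAt_snd hg p).differentiableAt.hasDerivAt)).deriv

/-- All decay is taken from `φ`. The factor `f` need only be bounded, so the resulting integration
by parts applies to plane waves as well as to Schwartz functions. -/
theorem norm_mul_le_decay {f : ℝ × ℝ → ℂ} {C : ℝ} (hf : ∀ p, ‖f p‖ ≤ C) (φ : Schwartz)
    (p : ℝ × ℝ) :
    ‖f p * φ.1 p‖ ≤ C * (semi 0 0 0 φ.1 + semi 0 0 2 φ.1) * (1 + p.2 ^ 2)⁻¹ := by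
  rw [norm_mul, mul_assoc]
  exact mul_le_mul (hf p) (norm_le_semi_mul_inv φ p) (norm_nonneg _)
    ((norm_nonneg _).trans (hf p))

theorem integrableOn_mul_schwartz {f : ℝ × ℝ → ℂ} (hc : Continuous f) {C : ℝ}
    (hf : ∀ p, ‖f p‖ ≤ C) (φ : Schwartz) : IntegrableOn (fun p => f p * φ.1 p) strip :=
  integrableOn_strip (hc.mul φ.2.1.continuous) (norm_mul_le_decay hf φ)

theorem integral_mul_dX {f : ℝ × ℝ → ℂ} (hf : ContDiff ℝ ∞ f) {C D : ℝ}
    (h0 : ∀ p, ‖f p‖ ≤ C) (h1 : ∀ p, ‖pdX f p‖ ≤ D) (φ : Schwartz) :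
    ∫ p in strip, f p * (Schwartz.dX φ).1 p = -∫ p in strip, pdX f p * φ.1 p := by
  have hm := pdX_mul hf φ.2.1
  have h := integral_pdX_eq_zero (hf.mul φ.2.1) (norm_mul_le_decay h0 φ) (fun p => by
    change ‖pdX (f * φ.1) p‖ ≤ _
    rw [hm]
    refine (norm_add_le _ _).trans (add_le_add (norm_mul_le_decay h1 φ p)
      (norm_mul_le_decay h0 (Schwartz.dX φ) p)) |>.trans_eq (add_mul _ _ _).symm)
  change ∫ p in strip, pdX (f * φ.1) p = 0 at h
  rw [hm] at h
  have ha := integral_add (integrableOn_mul_schwartz (contDiff_pdX hf).continuous h1 φ)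
    (integrableOn_mul_schwartz hf.continuous h0 (Schwartz.dX φ))
  exact eq_neg_of_add_eq_zero_right (ha.symm.trans h)

theorem integral_mul_dT {f : ℝ × ℝ → ℂ} (hf : ContDiff ℝ ∞ f)
    (hper : ∀ t x : ℝ, f (t + 2 * Real.pi, x) = f (t, x)) {C D : ℝ}
    (h0 : ∀ p, ‖f p‖ ≤ C) (h1 : ∀ p, ‖pdT f p‖ ≤ D) (φ : Schwartz) :
    ∫ p in strip, f p * (Schwartz.dT φ).1 p = -∫ p in strip, pdT f p * φ.1 p := by
  have hm := pdT_mul hf φ.2.1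
  have h := integral_pdT_eq_zero (hf.mul φ.2.1)
    (fun t x => congrArg₂ (· * ·) (hper t x) (φ.2.2.1 t x)) (fun p => by
    change ‖pdT (f * φ.1) p‖ ≤ _
    rw [hm]
    refine (norm_add_le _ _).trans (add_le_add (norm_mul_le_decay h1 φ p)
      (norm_mul_le_decay h0 (Schwartz.dT φ) p)) |>.trans_eq (add_mul _ _ _).symm)
  change ∫ p in strip, pdT (f * φ.1) p = 0 at h
  rw [hm] at h
  have ha := integral_add (integrableOn_mul_schwartz (contDiff_pdT hf).continuous h1 φ)
    (integrableOn_mul_schwartz hf.continuous h0 (Schwartz.dT φ))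
  exact eq_neg_of_add_eq_zero_right (ha.symm.trans h)

/-! ### The operator, its transpose and the duality argument. -/

/-- The operator `c₁ ∂ₜ + c₂ ∂ₓ + q` on `𝒮(𝕋¹ × ℝ)`. -/
def Schwartz.op (c₁ c₂ q : ℂ) : Schwartz →ₗ[ℂ] Schwartz :=
  c₁ • Schwartz.dT + c₂ • Schwartz.dX + q • LinearMap.id

/-- The operator `c₁ ∂ₜ + c₂ ∂ₓ + q` on `𝒮'(𝕋¹ × ℝ)`. -/
def op (c₁ c₂ q : ℂ) : Distr →ₗ[ℂ] Distr := c₁ • dT + c₂ • dX + q • LinearMap.id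

theorem op_apply (c₁ c₂ q : ℂ) (u : Distr) (φ : Schwartz) :
    (op c₁ c₂ q u).1 φ = u.1 (Schwartz.op (-c₁) (-c₂) q φ) := by
  have h1 : (op c₁ c₂ q u).1 φ
      = c₁ * -u.1 (Schwartz.dT φ) + c₂ * -u.1 (Schwartz.dX φ) + q * u.1 φ := rfl
  have h2 : Schwartz.op (-c₁) (-c₂) q φ
      = (-c₁) • Schwartz.dT φ + (-c₂) • Schwartz.dX φ + q • φ := rfl
  rw [h1, h2, map_add, map_add, map_smul, map_smul, map_smul]
  simp

theorem integral_lin_comb {α : Type*} [MeasurableSpace α] {μ : Measure α} {F G H : α → ℂ}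
    (hF : Integrable F μ) (hG : Integrable G μ) (hH : Integrable H μ) (a b c : ℂ) :
    ∫ p, (a * F p + b * G p + c * H p) ∂μ
      = a * ∫ p, F p ∂μ + b * ∫ p, G p ∂μ + c * ∫ p, H p ∂μ := by
  have h1 := integral_add ((hF.const_mul a).add (hG.const_mul b)) (hH.const_mul c)
  have h2 := integral_add (hF.const_mul a) (hG.const_mul b)
  simp only [Pi.add_apply] at h1
  rw [h1, h2, integral_const_mul, integral_const_mul, integral_const_mul]

/-- Integration by parts on the cylinder. -/
theorem integral_mul_op {f : ℝ × ℝ → ℂ} (hf : ContDiff ℝ ∞ f)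
    (hper : ∀ t x : ℝ, f (t + 2 * Real.pi, x) = f (t, x)) {C D E : ℝ}
    (h0 : ∀ p, ‖f p‖ ≤ C) (hT : ∀ p, ‖pdT f p‖ ≤ D) (hX : ∀ p, ‖pdX f p‖ ≤ E)
    (c₁ c₂ q : ℂ) (φ : Schwartz) :
    ∫ p in strip, f p * (Schwartz.op (-c₁) (-c₂) q φ).1 p
      = ∫ p in strip, (c₁ * pdT f p + c₂ * pdX f p + q * f p) * φ.1 p := by
  have e1 : ∀ p, f p * (Schwartz.op (-c₁) (-c₂) q φ).1 p
      = (-c₁) * (f p * (Schwartz.dT φ).1 p) + (-c₂) * (f p * (Schwartz.dX φ).1 p)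
        + q * (f p * φ.1 p) := fun p => by
    change f p * ((-c₁) * (Schwartz.dT φ).1 p + (-c₂) * (Schwartz.dX φ).1 p + q * φ.1 p) = _
    ring
  have e2 : ∀ p, (c₁ * pdT f p + c₂ * pdX f p + q * f p) * φ.1 p
      = c₁ * (pdT f p * φ.1 p) + c₂ * (pdX f p * φ.1 p) + q * (f p * φ.1 p) := fun p => by ring
  have i0 := fun φ : Schwartz => integrableOn_mul_schwartz hf.continuous h0 φ
  have iT := integrableOn_mul_schwartz (contDiff_pdT hf).continuous hT φ
  have iX := integrableOn_mul_schwartz (contDiff_pdX hf).continuous hX φ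
  simp_rw [e1, e2]
  rw [integral_lin_comb (i0 _) (i0 _) (i0 _), integral_lin_comb iT iX (i0 _)]
  simp only [integral_mul_dT hf hper h0 hT, integral_mul_dX hf h0 hX]
  ring

theorem norm_le_semi (f : Schwartz) (p : ℝ × ℝ) : ‖f.1 p‖ ≤ semi 0 0 0 f.1 := by
  simpa using pow_mul_norm_le_semi f 0 p

/-- Surjectivity on `𝒮` of the operator and of its transpose implies global hypoellipticity. -/
theorem globallyHypoelliptic_of_surjective {c₁ c₂ q : ℂ}
    (h : Function.Surjective (Schwartz.op c₁ c₂ q))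
    (h' : Function.Surjective (Schwartz.op (-c₁) (-c₂) q)) :
    GloballyHypoelliptic (op c₁ c₂ q) := by
  rintro u ⟨g, hg⟩
  obtain ⟨f, rfl⟩ := h g
  refine ⟨f, fun φ => ?_⟩
  -- Every test function is a transpose image, so the operator can be moved off `ψ`; then `u` and
  -- `f` both give the pairing of `ψ` with `Lf`.
  obtain ⟨ψ, rfl⟩ := h' φ
  rw [← op_apply, hg]
  exact (integral_mul_op f.2.1 f.2.2.1 (norm_le_semi f) (norm_le_semi (Schwartz.dT f))
    (norm_le_semi (Schwartz.dX f)) c₁ c₂ q ψ).symm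

/-! ### Fourier coefficients in `t`. -/

/-- The `k`-th Fourier coefficient in the periodic variable. -/
def coef (k : ℤ) (g : Schwartz) (x : ℝ) : ℂ :=
  ((1 / (2 * Real.pi) : ℝ) : ℂ) * ∫ t in (0 : ℝ)..2 * Real.pi, exp (I * (-k : ℤ) * t) * g.1 (t, x)

theorem continuous_exp_mode (k : ℤ) : Continuous fun t : ℝ => exp (I * k * t) := by fun_prop

theorem continuous_fst_slice (g : Schwartz) (x : ℝ) : Continuous fun t : ℝ => g.1 (t, x) :=
  g.2.1.continuous.comp (by fun_prop)

theorem hasDerivAt_coef (k : ℤ) (g : Schwartz) (x : ℝ) :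
    HasDerivAt (coef k g) (coef k (Schwartz.dX g) x) x := by
  refine HasDerivAt.const_mul _ ?_
  refine (intervalIntegral.hasDerivAt_integral_of_dominated_loc_of_deriv_le
    (F := fun x t => exp (I * (-k : ℤ) * t) * g.1 (t, x))
    (F' := fun x t => exp (I * (-k : ℤ) * t) * (Schwartz.dX g).1 (t, x))
    (bound := fun _ => semi 0 0 0 (Schwartz.dX g).1)
    Filter.univ_mem ?_ ?_ ?_ ?_ ?_ ?_).2
  · exact Filter.Eventually.of_forall fun y =>
      ((continuous_exp_mode _).mul (continuous_fst_slice g y)).aestronglyMeasurable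
  · exact ((continuous_exp_mode _).mul (continuous_fst_slice g x)).intervalIntegrable _ _
  · exact ((continuous_exp_mode _).mul (continuous_fst_slice _ x)).aestronglyMeasurable
  · refine ae_of_all _ fun t _ y _ => ?_
    rw [norm_mul, norm_exp_mode, one_mul]
    exact norm_le_semi (Schwartz.dX g) (t, y)
  · exact intervalIntegrable_const
  · exact ae_of_all _ fun t _ y _ =>
      ((hasDerivAt_snd g.2.1 (t, y)).differentiableAt.hasDerivAt).const_mul _

theorem coef_dT (k : ℤ) (g : Schwartz) (x : ℝ) :
    coef k (Schwartz.dT g) x = I * k * coef k g x := by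
  have h := intervalIntegral.integral_mul_deriv_eq_deriv_mul (a := 0) (b := 2 * Real.pi)
    (u := fun t : ℝ => exp (I * (-k : ℤ) * t)) (v := fun t => g.1 (t, x))
    (v' := fun t => (Schwartz.dT g).1 (t, x))
    (fun t _ => hasDerivAt_exp_mode (-k) t)
    (fun t _ => (hasDerivAt_fst g.2.1 (t, x)).differentiableAt.hasDerivAt)
    (((continuous_exp_mode (-k)).const_mul _).intervalIntegrable _ _)
    ((continuous_fst_slice _ x).intervalIntegrable _ _)
  have he : exp (I * (-k : ℤ) * ((2 * Real.pi : ℝ) : ℂ)) = 1 := by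
    have : I * (-k : ℤ) * ((2 * Real.pi : ℝ) : ℂ) = (-k : ℤ) * (2 * Real.pi * I) := by
      push_cast; ring
    rw [this, Complex.exp_int_mul_two_pi_mul_I]
  have hp := g.2.2.1 0 x
  rw [zero_add] at hp
  rw [he, hp] at h
  simp only [mul_assoc, intervalIntegral.integral_const_mul] at h
  simp only [coef, mul_assoc, h]
  push_cast
  simp
  ring

theorem norm_coef_le (k : ℤ) (g : Schwartz) (γ : ℕ) (x : ℝ) :
    |x| ^ γ * ‖coef k g x‖ ≤ semi 0 0 γ g.1 := by
  have hn : ‖((|x| ^ γ : ℝ) : ℂ)‖ = |x| ^ γ := by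
    rw [Complex.norm_real, Real.norm_of_nonneg (by positivity)]
  have h : ‖∫ t in (0 : ℝ)..2 * Real.pi,
      ((|x| ^ γ : ℝ) : ℂ) * (exp (I * (-k : ℤ) * t) * g.1 (t, x))‖
        ≤ semi 0 0 γ g.1 * |2 * Real.pi - 0| := by
    refine intervalIntegral.norm_integral_le_of_norm_le_const fun t _ => ?_
    rw [norm_mul, norm_mul, hn, norm_exp_mode, one_mul]
    exact pow_mul_norm_le_semi g γ (t, x)
  rw [intervalIntegral.integral_const_mul, norm_mul, hn, sub_zero,
    abs_of_pos Real.two_pi_pos] at h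
  rw [coef, norm_mul, Complex.norm_real, Real.norm_of_nonneg (by positivity), mul_left_comm,
    one_div, inv_mul_le_iff₀ Real.two_pi_pos]
  linarith

theorem isModeFamily_coef : IsModeFamily coef where
  hasDerivAt := hasDerivAt_coef
  map_dT := coef_dT
  bound g γ := ⟨_, fun k x => norm_coef_le k g γ x⟩

/-- For fixed `x`, the slice `t ↦ g(t, x)` descends to a continuous function on the circle. Its
Fourier coefficients are summable by `decay`, so its Fourier series converges pointwise to it. -/
theorem synth_coef (g : Schwartz) : synth coef g = g.1 := by
  have : Fact (0 < 2 * Real.pi) := ⟨Real.two_pi_pos⟩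
  funext p
  obtain ⟨t, x⟩ := p
  have hper : Function.Periodic (fun t => g.1 (t, x)) (2 * Real.pi) := fun t => g.2.2.1 t x
  let f : C(AddCircle (2 * Real.pi), ℂ) :=
    ⟨hper.lift, continuous_coinduced_dom.mpr (continuous_fst_slice g x)⟩
  have hmode : ∀ (k : ℤ) (s : ℝ),
      fourier k (s : AddCircle (2 * Real.pi)) = exp (I * k * s) := fun k s => by
    rw [fourier_coe_apply]
    congr 1
    have : (Real.pi : ℂ) ≠ 0 := by exact_mod_cast Real.pi_ne_zero
    push_cast
    field_simp
  have hc : ∀ k, fourierCoeff f k = coef k g x := fun k => by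
    rw [fourierCoeff_eq_intervalIntegral f k 0, zero_add, coef, Complex.real_smul]
    congr 1
    refine intervalIntegral.integral_congr fun s _ => ?_
    change fourier (-k) (s : AddCircle (2 * Real.pi)) * g.1 (s, x) = _
    rw [hmode]
  have hs : Summable (fourierCoeff f) := by
    obtain ⟨C, hC⟩ := isModeFamily_coef.decay g 0
    refine Summable.of_norm_bounded (summable_modeWeight.mul_left C) fun k => ?_
    rw [hc]
    simpa using hC k x
  have h := (has_pointwise_sum_fourier_series_of_summable hs (t : AddCircle (2 * Real.pi))).tsum_eq
  refine Eq.trans (tsum_congr fun k => ?_) h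
  rw [hc, hmode, smul_eq_mul, mul_comm]

/-! ### Solving the equation on each mode, uniformly in `k`. -/

/-- A mode family which inverts the operator on each Fourier mode yields a solution operator. -/
theorem IsModeFamily.surjective_op {T : ℤ → Schwartz → ℝ → ℂ} (hT : IsModeFamily T)
    {c₁ c₂ q : ℂ}
    (h : ∀ k g x, (c₁ * (I * k) + q) * T k g x + c₂ * T k (Schwartz.dX g) x = coef k g x) :
    Function.Surjective (Schwartz.op c₁ c₂ q) := by
  intro g
  refine ⟨⟨synth T g, hT.synth_mem g⟩, Subtype.ext (funext fun p => ?_)⟩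
  change c₁ * pdT (synth T g) p + c₂ * pdX (synth T g) p + q * synth T g p = g.1 p
  rw [hT.pdT_synth, hT.pdX_synth, ← synth_coef g]
  simp only [synth]
  rw [← tsum_mul_left, ← tsum_mul_left, ← tsum_mul_left,
    ← ((hT.summable _ p).mul_left _).tsum_add ((hT.summable _ p).mul_left _),
    ← (((hT.summable _ p).mul_left _).add ((hT.summable _ p).mul_left _)).tsum_add
      ((hT.summable _ p).mul_left _)]
  refine tsum_congr fun k => ?_
  rw [← h, hT.map_dT]
  ring

theorem IsModeFamily.const_mul {T : ℤ → Schwartz → ℝ → ℂ} (hT : IsModeFamily T)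
    {m : ℤ → ℂ} {M : ℝ} (hm : ∀ k, ‖m k‖ ≤ M) : IsModeFamily fun k g x => m k * T k g x where
  hasDerivAt k g x := (hT.hasDerivAt k g x).const_mul _
  map_dT k g x := by rw [hT.map_dT]; ring
  bound g γ := by
    obtain ⟨C, hC⟩ := hT.bound g γ
    refine ⟨M * C, fun k x => ?_⟩
    rw [norm_mul, mul_left_comm]
    exact mul_le_mul (hm k) (hC k x) (by positivity) ((norm_nonneg _).trans (hm k))

/-- The operator `f ↦ ∫₀^∞ e^{-μₖ s} f(x - εₖ s) ds` applied to the `k`-th mode. -/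
def halfLine (ε : ℤ → ℝ) (μ : ℤ → ℂ) (T : ℤ → Schwartz → ℝ → ℂ) (k : ℤ) (g : Schwartz)
    (x : ℝ) : ℂ :=
  ∫ s in Set.Ioi (0 : ℝ), exp (-μ k * s) * T k g (x - ε k * s)

theorem integrableOn_pow_mul_exp_neg (n : ℕ) {δ : ℝ} (hδ : 0 < δ) :
    IntegrableOn (fun s : ℝ => s ^ n * Real.exp (-δ * s)) (Set.Ioi 0) := by
  have h := integrableOn_rpow_mul_exp_neg_mul_rpow (p := 1) (s := n) (b := δ)
    (by have : (0 : ℝ) ≤ n := n.cast_nonneg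
        linarith) one_pos hδ
  simpa using h

theorem norm_exp_neg_mul_le {μ : ℂ} {δ s : ℝ} (h : δ ≤ μ.re) (hs : 0 ≤ s) :
    ‖exp (-μ * s)‖ ≤ Real.exp (-δ * s) := by
  rw [Complex.norm_exp]
  refine Real.exp_le_exp.2 ?_
  have : (-μ * s).re = -(μ.re * s) := by simp
  rw [this]
  nlinarith

namespace IsModeFamily

variable {T : ℤ → Schwartz → ℝ → ℂ} (hT : IsModeFamily T)
include hT

theorem continuous (k : ℤ) (g : Schwartz) : Continuous (T k g) :=
  continuous_iff_continuousAt.2 fun x => (hT.hasDerivAt k g x).continuousAt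

theorem continuous_integrand (ε : ℤ → ℝ) (μ : ℤ → ℂ) (k : ℤ) (g : Schwartz) (x : ℝ) :
    Continuous fun s : ℝ => exp (-μ k * s) * T k g (x - ε k * s) := by
  have := hT.continuous k g
  fun_prop

theorem norm_integrand_le {μ : ℤ → ℂ} {δ : ℝ} (hμ : ∀ k, δ ≤ (μ k).re) (g : Schwartz) :
    ∃ C, ∀ (k : ℤ) (y s : ℝ), 0 < s →
      ‖exp (-μ k * s) * T k g y‖ ≤ C * Real.exp (-δ * s) := by
  obtain ⟨C, hC⟩ := hT.bound g 0
  have hC' : ∀ k y, ‖T k g y‖ ≤ C := fun k y => by simpa using hC k y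
  refine ⟨C, fun k y s hs => ?_⟩
  rw [norm_mul, mul_comm C]
  exact mul_le_mul (norm_exp_neg_mul_le (hμ k) hs.le) (hC' k y) (norm_nonneg _)
    (Real.exp_pos _).le

theorem integrableOn_integrand (ε : ℤ → ℝ) {μ : ℤ → ℂ} {δ : ℝ} (hδ : 0 < δ)
    (hμ : ∀ k, δ ≤ (μ k).re) (k : ℤ) (g : Schwartz) (x : ℝ) :
    IntegrableOn (fun s : ℝ => exp (-μ k * s) * T k g (x - ε k * s)) (Set.Ioi 0) := by
  obtain ⟨C, hC⟩ := hT.norm_integrand_le hμ g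
  refine ((exp_neg_integrableOn_Ioi 0 hδ).const_mul C).mono'
    (hT.continuous_integrand ε μ k g x).aestronglyMeasurable ?_
  exact (ae_restrict_iff' measurableSet_Ioi).2 (ae_of_all _ fun s hs => hC k _ s hs)

theorem hasDerivAt_halfLine (ε : ℤ → ℝ) {μ : ℤ → ℂ} {δ : ℝ} (hδ : 0 < δ)
    (hμ : ∀ k, δ ≤ (μ k).re) (k : ℤ) (g : Schwartz) (x : ℝ) :
    HasDerivAt (halfLine ε μ T k g) (halfLine ε μ T k (Schwartz.dX g) x) x := by
  obtain ⟨C, hC⟩ := hT.norm_integrand_le hμ (Schwartz.dX g)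
  refine (hasDerivAt_integral_of_dominated_loc_of_deriv_le
    (F := fun x s => exp (-μ k * s) * T k g (x - ε k * s))
    (F' := fun x s => exp (-μ k * s) * T k (Schwartz.dX g) (x - ε k * s))
    (bound := fun s => C * Real.exp (-δ * s))
    Filter.univ_mem ?_ (hT.integrableOn_integrand ε hδ hμ k g x) ?_ ?_ ?_ ?_).2
  · exact Filter.Eventually.of_forall fun y =>
      (hT.continuous_integrand ε μ k g y).aestronglyMeasurable
  · exact (hT.continuous_integrand ε μ k _ x).aestronglyMeasurable
  · exact (ae_restrict_iff' measurableSet_Ioi).2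
      (ae_of_all _ fun s hs y _ => hC k _ s hs)
  · exact (exp_neg_integrableOn_Ioi 0 hδ).const_mul C
  · refine ae_of_all _ fun s y _ => HasDerivAt.const_mul _ ?_
    exact (hT.hasDerivAt k g (y - ε k * s)).comp_sub_const y (ε k * s)

theorem bound_halfLine {ε : ℤ → ℝ} (hε : ∀ k, |ε k| ≤ 1) {μ : ℤ → ℂ} {δ : ℝ} (hδ : 0 < δ)
    (hμ : ∀ k, δ ≤ (μ k).re) (g : Schwartz) (γ : ℕ) :
    ∃ C, ∀ k x, |x| ^ γ * ‖halfLine ε μ T k g x‖ ≤ C := by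
  obtain ⟨A, hA⟩ := hT.bound g γ
  obtain ⟨B, hB⟩ := hT.bound g 0
  simp only [pow_zero, one_mul] at hB
  refine ⟨∫ s in Set.Ioi (0 : ℝ), (2 ^ (γ - 1) * A * Real.exp (-δ * s)
    + 2 ^ (γ - 1) * B * (s ^ γ * Real.exp (-δ * s))), fun k x => ?_⟩
  have hn : ‖((|x| ^ γ : ℝ) : ℂ)‖ = |x| ^ γ := by
    rw [Complex.norm_real, Real.norm_of_nonneg (by positivity)]
  rw [← hn, ← norm_mul, halfLine, ← integral_const_mul]
  refine norm_integral_le_of_norm_le (((exp_neg_integrableOn_Ioi 0 hδ).const_mul _).add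
    ((integrableOn_pow_mul_exp_neg γ hδ).const_mul _)) ?_
  refine (ae_restrict_iff' measurableSet_Ioi).2 (ae_of_all _ fun s hs => ?_)
  have hs : 0 < s := hs
  set y := x - ε k * s with hy
  -- The weight at `x` is split between the translated point `y` and the shift `s`; the powers of
  -- `s` are absorbed by `e^{-δs}`.
  have hx : |x| ≤ |y| + s := by
    have h1 : x = y + ε k * s := by rw [hy]; ring
    calc |x| = |y + ε k * s| := by rw [← h1]
      _ ≤ |y| + |ε k * s| := abs_add_le _ _
      _ ≤ |y| + s := by
        rw [abs_mul, abs_of_pos hs]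
        nlinarith [hε k]
  -- For `γ = 0` the truncated exponent `γ - 1` is `0`, and the inequality reads `1 ≤ 2`.
  have hpow : |x| ^ γ ≤ 2 ^ (γ - 1) * (|y| ^ γ + s ^ γ) :=
    (pow_le_pow_left₀ (abs_nonneg x) hx γ).trans (add_pow_le (abs_nonneg y) hs.le γ)
  have hTb : |x| ^ γ * ‖T k g y‖ ≤ 2 ^ (γ - 1) * (A + s ^ γ * B) := by
    calc |x| ^ γ * ‖T k g y‖ ≤ 2 ^ (γ - 1) * (|y| ^ γ + s ^ γ) * ‖T k g y‖ := by gcongr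
      _ = 2 ^ (γ - 1) * (|y| ^ γ * ‖T k g y‖ + s ^ γ * ‖T k g y‖) := by ring
      _ ≤ 2 ^ (γ - 1) * (A + s ^ γ * B) := by gcongr; exacts [hA k y, hB k y]
  rw [norm_mul, norm_mul, hn]
  calc |x| ^ γ * (‖exp (-μ k * s)‖ * ‖T k g y‖)
      = ‖exp (-μ k * s)‖ * (|x| ^ γ * ‖T k g y‖) := by ring
    _ ≤ Real.exp (-δ * s) * (2 ^ (γ - 1) * (A + s ^ γ * B)) :=
        mul_le_mul (norm_exp_neg_mul_le (hμ k) hs.le) hTb (by positivity) (Real.exp_pos _).le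
    _ = _ := by ring

theorem isModeFamily_halfLine {ε : ℤ → ℝ} (hε : ∀ k, |ε k| ≤ 1) {μ : ℤ → ℂ} {δ : ℝ}
    (hδ : 0 < δ) (hμ : ∀ k, δ ≤ (μ k).re) : IsModeFamily (halfLine ε μ T) where
  hasDerivAt := hT.hasDerivAt_halfLine ε hδ hμ
  map_dT k g x := by
    simp only [halfLine, ← integral_const_mul, hT.map_dT]
    exact integral_congr_ae (ae_of_all _ fun s => by ring)
  bound := hT.bound_halfLine hε hδ hμ

/-- Minus the `s`-derivative of `e^{-μs} T g(x - εs)` is the integrand of the left side. Integrating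
over `(0, ∞)` leaves only the value at `s = 0`, since the integrand vanishes at infinity. -/
theorem halfLine_add_halfLine_dX (ε : ℤ → ℝ) {μ : ℤ → ℂ} {δ : ℝ} (hδ : 0 < δ)
    (hμ : ∀ k, δ ≤ (μ k).re) (k : ℤ) (g : Schwartz) (x : ℝ) :
    μ k * halfLine ε μ T k g x + ε k * halfLine ε μ T k (Schwartz.dX g) x = T k g x := by
  have hd : ∀ s : ℝ, HasDerivAt (fun s : ℝ => exp (-μ k * s) * T k g (x - ε k * s))
      (-(μ k * (exp (-μ k * s) * T k g (x - ε k * s))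
        + ε k * (exp (-μ k * s) * T k (Schwartz.dX g) (x - ε k * s)))) s := fun s => by
    have h1 : HasDerivAt (fun s : ℝ => -μ k * (s : ℂ)) (-μ k) s := by
      simpa using (Complex.ofRealCLM.hasDerivAt (x := s)).const_mul (-μ k)
    have h2 : HasDerivAt (fun s : ℝ => x - ε k * s) (-ε k) s := by
      simpa using ((hasDerivAt_id s).const_mul (ε k)).const_sub x
    have h3 := (hT.hasDerivAt k g (x - ε k * s)).scomp s h2
    refine (h1.cexp.mul h3).congr_deriv ?_
    simp only [Complex.real_smul, Function.comp_apply]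
    push_cast
    ring
  have i1 := (hT.integrableOn_integrand ε hδ hμ k g x).const_mul (μ k)
  have i2 := (hT.integrableOn_integrand ε hδ hμ k (Schwartz.dX g) x).const_mul (ε k : ℂ)
  obtain ⟨C, hC⟩ := hT.norm_integrand_le hμ g
  have hlim : Filter.Tendsto (fun s : ℝ => exp (-μ k * s) * T k g (x - ε k * s)) Filter.atTop
      (nhds 0) := by
    have h0 : Filter.Tendsto (fun s : ℝ => C * Real.exp (-δ * s)) Filter.atTop (nhds 0) := by
      have := (Real.tendsto_exp_atBot.comp
        (Filter.tendsto_id.const_mul_atTop_of_neg (neg_neg_iff_pos.2 hδ))).const_mul C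
      simpa using this
    refine squeeze_zero_norm' ?_ h0
    filter_upwards [Filter.eventually_gt_atTop 0] with s hs using hC k _ s hs
  have h := integral_Ioi_of_hasDerivAt_of_tendsto' (a := 0) (fun s _ => hd s)
    (i1.add i2).neg hlim
  have ha := integral_add i1 i2
  have h0 : exp (-μ k * (0 : ℝ)) * T k g (x - ε k * 0) = T k g x := by simp
  rw [integral_neg, ha, integral_const_mul, integral_const_mul, h0, zero_sub] at h
  exact neg_inj.1 h

end IsModeFamily

/-! ### Uniform lower bounds and surjectivity on `𝒮`. -/

/-- For `A ≠ 0` the minimum over `k` is attained at the integer nearest to `-B / A`. This is why no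
Diophantine condition enters the theorem. -/
theorem exists_pos_le_abs_affine {A B : ℝ} (h : ∀ k : ℤ, A * k + B ≠ 0) :
    ∃ δ > 0, ∀ k : ℤ, δ ≤ |A * k + B| := by
  by_cases hA : A = 0
  · exact ⟨|A * (0 : ℤ) + B|, abs_pos.2 (h 0), fun k => by simp [hA]⟩
  · have key : ∀ k : ℤ, |A * k + B| = |A| * |-B / A - k| := fun k => by
      rw [← abs_mul, ← abs_neg]
      congr 1
      field_simp
      ring
    refine ⟨_, abs_pos.2 (h (round (-B / A))), fun k => ?_⟩
    rw [key, key]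
    exact mul_le_mul_of_nonneg_left (round_le _ _) (abs_nonneg A)

/-- With `ε` the sign of `Re r_k`, the equation `f' + r_k f = g_k / c₂` is multiplied by `ε`, so
that the zeroth-order coefficient `ε r_k` has real part `|Re r_k| ≥ δ`. The half-line integral then
converges, running to the left or to the right according to `ε`. -/
theorem surjective_op_of_re_ne_zero {c₁ c₂ q : ℂ} (hc : c₂ ≠ 0)
    (h : ∀ k : ℤ, ((c₁ * (I * k) + q) / c₂).re ≠ 0) :
    Function.Surjective (Schwartz.op c₁ c₂ q) := by
  have haff : ∀ k : ℤ, ((c₁ * (I * k) + q) / c₂).re = (c₁ * I / c₂).re * k + (q / c₂).re :=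
    fun k => by
      have : (c₁ * (I * k) + q) / c₂ = (k : ℝ) * (c₁ * I / c₂) + q / c₂ := by
        push_cast; ring
      rw [this, Complex.add_re, Complex.re_ofReal_mul, mul_comm]
  obtain ⟨δ, hδ, hle⟩ := exists_pos_le_abs_affine (fun k => haff k ▸ h k)
  simp only [← haff] at hle
  set r : ℤ → ℂ := fun k => (c₁ * (I * k) + q) / c₂ with hr
  let ε : ℤ → ℝ := fun k => SignType.sign (r k).re
  have hεe : ∀ k, ε k * (r k).re = |(r k).re| := fun k => sign_mul_self _
  have hε1 : ∀ k, |ε k| ≤ 1 := fun k => by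
    rcases lt_or_gt_of_ne (h k) with h0 | h0
    · simp [ε, r, sign_neg h0]
    · simp [ε, r, sign_pos h0]
  have hμ : ∀ k, δ ≤ ((fun k => (ε k : ℂ) * r k) k).re := fun k => by
    change δ ≤ ((ε k : ℂ) * r k).re
    rw [Complex.re_ofReal_mul, hεe]
    exact hle k
  have hH := isModeFamily_coef.isModeFamily_halfLine hε1 hδ hμ
  have hm : ∀ k, ‖(ε k : ℂ) / c₂‖ ≤ 1 / ‖c₂‖ := fun k => by
    rw [norm_div, Complex.norm_real]
    exact div_le_div_of_nonneg_right (hε1 k) (norm_nonneg _)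
  refine (hH.const_mul hm).surjective_op fun k g x => ?_
  have hk := isModeFamily_coef.halfLine_add_halfLine_dX ε hδ hμ k g x
  have hrk : c₁ * (I * k) + q = c₂ * r k := by rw [hr]; field_simp
  rw [hrk, ← hk]
  field_simp

theorem surjective_op_of_norm_ge {c₁ q : ℂ} {δ : ℝ} (hδ : 0 < δ)
    (h : ∀ k : ℤ, δ ≤ ‖c₁ * (I * k) + q‖) : Function.Surjective (Schwartz.op c₁ 0 q) := by
  have hm : ∀ k : ℤ, ‖(c₁ * (I * k) + q)⁻¹‖ ≤ δ⁻¹ := fun k => by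
    rw [norm_inv]; exact inv_anti₀ hδ (h k)
  refine (isModeFamily_coef.const_mul hm).surjective_op fun k g x => ?_
  have h0 : c₁ * (I * k) + q ≠ 0 := norm_pos_iff.1 (hδ.trans_le (h k))
  rw [zero_mul, add_zero, mul_inv_cancel_left₀ h0]

/-! ### Plane waves in the kernel and why they are not Schwartz. -/

/-- The function `(t, x) ↦ e^{ikt} ρ(x)`. -/
def modeFun (k : ℤ) (ρ : ℝ → ℂ) (p : ℝ × ℝ) : ℂ := exp (I * k * p.1) * ρ p.2

theorem contDiff_modeFun (k : ℤ) {ρ : ℝ → ℂ} (hρ : ContDiff ℝ ∞ ρ) :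
    ContDiff ℝ ∞ (modeFun k ρ) := by
  have h1 : ContDiff ℝ ∞ fun p : ℝ × ℝ => exp (I * k * p.1) :=
    (contDiff_const.mul (Complex.ofRealCLM.contDiff.comp contDiff_fst)).cexp
  exact h1.mul (hρ.comp contDiff_snd)

theorem modeFun_periodic (k : ℤ) (ρ : ℝ → ℂ) (t x : ℝ) :
    modeFun k ρ (t + 2 * Real.pi, x) = modeFun k ρ (t, x) := by
  have : I * k * ((t + 2 * Real.pi : ℝ) : ℂ) = I * k * t + k * (2 * Real.pi * I) := by
    push_cast; ring
  simp only [modeFun]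
  rw [this, Complex.exp_add, Complex.exp_int_mul_two_pi_mul_I, mul_one]

theorem norm_modeFun (k : ℤ) (ρ : ℝ → ℂ) (p : ℝ × ℝ) : ‖modeFun k ρ p‖ = ‖ρ p.2‖ := by
  rw [modeFun, norm_mul, norm_exp_mode, one_mul]

theorem pdT_modeFun (k : ℤ) (ρ : ℝ → ℂ) : pdT (modeFun k ρ) = (I * k) • modeFun k ρ := by
  funext p
  refine ((hasDerivAt_exp_mode k p.1).mul_const (ρ p.2)).deriv.trans ?_
  simp [modeFun, mul_assoc]

theorem pdX_modeFun (k : ℤ) (ρ : ℝ → ℂ) : pdX (modeFun k ρ) = modeFun k (deriv ρ) := by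
  funext p
  exact deriv_const_mul_field (𝕜 := ℝ) (v := ρ) (x := p.2) (exp (I * k * p.1))

theorem iter_pdX_modeFun (k : ℤ) (ρ : 𝓢(ℝ, ℂ)) (n : ℕ) :
    pdX^[n] (modeFun k ρ) = modeFun k ((SchwartzMap.derivCLM ℂ ℂ)^[n] ρ) := by
  induction n generalizing ρ with
  | zero => rfl
  | succ n ih =>
    rw [Function.iterate_succ_apply, Function.iterate_succ_apply, pdX_modeFun, ← ih]
    rfl

theorem iter_pdT_modeFun (k : ℤ) {ρ : ℝ → ℂ} (hρ : ContDiff ℝ ∞ ρ) (n : ℕ) :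
    pdT^[n] (modeFun k ρ) = (I * k) ^ n • modeFun k ρ := by
  induction n with
  | zero => simp
  | succ n ih =>
    rw [Function.iterate_succ_apply', ih, pdT_smul _ (contDiff_modeFun k hρ), pdT_modeFun,
      smul_smul, pow_succ]

theorem modeFun_mem (k : ℤ) (ρ : 𝓢(ℝ, ℂ)) : modeFun k ρ ∈ Schwartz := by
  refine ⟨contDiff_modeFun k (ρ.smooth ⊤), modeFun_periodic k ρ, fun α β γ => ?_⟩
  obtain ⟨C, hC⟩ := ((SchwartzMap.derivCLM ℂ ℂ)^[β] ρ).decay γ 0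
  refine ⟨‖(I * (k : ℂ)) ^ α‖ * C, ?_⟩
  rintro _ ⟨p, rfl⟩
  rw [weighted, iter_pdX_modeFun, iter_pdT_modeFun k (SchwartzMap.smooth _ ⊤), Pi.smul_apply,
    norm_smul, norm_modeFun, mul_left_comm]
  refine mul_le_mul_of_nonneg_left ?_ (norm_nonneg _)
  simpa using hC.2 p.2

/-- The plane wave `e^{i(kt + ξx)}`. -/
def planeWave (k : ℤ) (ξ : ℝ) : ℝ × ℝ → ℂ := modeFun k fun x => exp (I * ξ * x)

theorem contDiff_exp_line (ξ : ℝ) : ContDiff ℝ ∞ fun x : ℝ => exp (I * ξ * x) :=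
  (contDiff_const.mul Complex.ofRealCLM.contDiff).cexp

theorem norm_exp_line (ξ x : ℝ) : ‖exp (I * ξ * x)‖ = 1 := by
  rw [Complex.norm_exp]; simp

theorem contDiff_planeWave (k : ℤ) (ξ : ℝ) : ContDiff ℝ ∞ (planeWave k ξ) :=
  contDiff_modeFun k (contDiff_exp_line ξ)

theorem norm_planeWave (k : ℤ) (ξ : ℝ) (p : ℝ × ℝ) : ‖planeWave k ξ p‖ = 1 :=
  (norm_modeFun _ _ _).trans (norm_exp_line _ _)

theorem pdX_planeWave (k : ℤ) (ξ : ℝ) : pdX (planeWave k ξ) = (I * ξ) • planeWave k ξ := by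
  have h : ∀ x : ℝ, HasDerivAt (fun x : ℝ => exp (I * ξ * x)) (I * ξ * exp (I * ξ * x)) x :=
    fun x => by
      have h : HasDerivAt (fun x : ℝ => I * ξ * (x : ℂ)) (I * ξ) x := by
        simpa using (Complex.ofRealCLM.hasDerivAt (x := x)).const_mul (I * (ξ : ℂ))
      simpa [mul_comm] using h.cexp
  rw [planeWave, pdX_modeFun]
  funext p
  simp only [modeFun, (h _).deriv, Pi.smul_apply, smul_eq_mul]
  ring

/-- The distribution defined by a plane wave. -/
def planeDistr (k : ℤ) (ξ : ℝ) : Distr where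
  val :=
    { toFun := fun φ => ∫ p in strip, planeWave k ξ p * φ.1 p
      map_add' := fun φ ψ => by
        have hi := fun φ => integrableOn_mul_schwartz (contDiff_planeWave k ξ).continuous
          (fun p => (norm_planeWave k ξ p).le) φ
        rw [← integral_add (hi φ) (hi ψ)]
        exact integral_congr_ae (ae_of_all _ fun p => mul_add _ _ _)
      map_smul' := fun c φ => by
        rw [RingHom.id_apply, smul_eq_mul, ← integral_const_mul]
        exact integral_congr_ae (ae_of_all _ fun p => mul_left_comm _ _ _) }
  property := by
    set K := ∫ p in strip, (1 : ℝ) * (1 + p.2 ^ 2)⁻¹ with hK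
    have hK0 : 0 ≤ K := integral_nonneg fun p => by positivity
    -- Order `2` supplies the weight `1 + x²` that makes the pairing integrable. Adding `1` makes
    -- the constant positive when only `0 ≤ K` is known.
    refine ⟨2, K + 1, by linarith, fun φ => ?_⟩
    have hs : semi 0 0 0 φ.1 + semi 0 0 2 φ.1 ≤ pNorm 2 φ.1 := by
      have := Finset.sum_le_sum_of_subset_of_nonneg
        (f := fun i : ℕ × ℕ × ℕ => semi i.1 i.2.1 i.2.2 φ.1)
        (s := {(0, 0, 0), (0, 0, 2)}) (t := indices 2) (by decide)
        fun i _ _ => semi_nonneg i.1 i.2.1 i.2.2 φ.1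
      rwa [Finset.sum_pair (by decide)] at this
    have hb := norm_integral_le_of_norm_le (integrableOn_strip_inv
      (1 * (semi 0 0 0 φ.1 + semi 0 0 2 φ.1)))
      (ae_of_all _ (norm_mul_le_decay (fun p => (norm_planeWave k ξ p).le) φ))
    refine hb.trans ?_
    rw [integral_const_mul]
    simp only [one_mul] at hK ⊢
    rw [← hK]
    nlinarith [pNorm_nonneg 2 φ.1]

theorem op_planeDistr {c₁ c₂ q : ℂ} {k : ℤ} {ξ : ℝ} (h : c₁ * (I * k) + c₂ * (I * ξ) + q = 0) :
    op c₁ c₂ q (planeDistr k ξ) = 0 := by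
  refine Subtype.ext (LinearMap.ext fun φ => ?_)
  rw [op_apply]
  have hT : pdT (planeWave k ξ) = (I * k) • planeWave k ξ := pdT_modeFun k _
  have hX := pdX_planeWave k ξ
  refine (integral_mul_op (contDiff_planeWave k ξ) (modeFun_periodic k _)
    (fun p => (norm_planeWave k ξ p).le) (D := ‖I * (k : ℂ)‖) (E := ‖I * (ξ : ℂ)‖)
    (fun p => ?_) (fun p => ?_) c₁ c₂ q φ).trans ?_
  · rw [hT, Pi.smul_apply, norm_smul, norm_planeWave, mul_one]
  · rw [hX, Pi.smul_apply, norm_smul, norm_planeWave, mul_one]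
  · refine integral_eq_zero_of_ae (ae_of_all _ fun p => ?_)
    change (c₁ * pdT (planeWave k ξ) p + c₂ * pdX (planeWave k ξ) p + q * planeWave k ξ p)
      * φ.1 p = 0
    rw [hT, hX, Pi.smul_apply, Pi.smul_apply, smul_eq_mul, smul_eq_mul]
    linear_combination planeWave k ξ p * φ.1 p * h

/-- The bump function, equal to `1` near `0`, used to localize in `x`. -/
def bump : ContDiffBump (0 : ℝ) := ⟨1, 2, one_pos, one_lt_two⟩

/-- The function `x ↦ e^{-iξx} χ(x - y)` for a bump function `χ`. -/
def wavePacket (ξ y : ℝ) : 𝓢(ℝ, ℂ) :=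
  HasCompactSupport.toSchwartzMap
    (f := fun x : ℝ => exp (I * (-ξ : ℝ) * x) * ((bump (x - y) : ℝ) : ℂ))
    (by
      refine HasCompactSupport.mul_left ?_
      have h := bump.hasCompactSupport.comp_homeomorph (Homeomorph.subRight y)
      exact h.comp_left Complex.ofReal_zero)
    ((contDiff_exp_line (-ξ)).mul
      (Complex.ofRealCLM.contDiff.comp (bump.contDiff.comp (contDiff_id.sub contDiff_const))))

theorem wavePacket_apply (ξ y x : ℝ) :
    wavePacket ξ y x = exp (I * (-ξ : ℝ) * x) * ((bump (x - y) : ℝ) : ℂ) := rfl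

/-- A localized plane wave of frequency `(-k, -ξ)`. -/
def testFun (k : ℤ) (ξ y : ℝ) : Schwartz := ⟨modeFun (-k) (wavePacket ξ y), modeFun_mem _ _⟩

theorem norm_testFun (k : ℤ) (ξ y : ℝ) (p : ℝ × ℝ) :
    ‖(testFun k ξ y).1 p‖ = bump (p.2 - y) := by
  change ‖modeFun (-k) (wavePacket ξ y) p‖ = _
  rw [norm_modeFun, wavePacket_apply, norm_mul, norm_exp_line, one_mul, Complex.norm_real,
    Real.norm_of_nonneg bump.nonneg]

theorem planeWave_mul_testFun (k : ℤ) (ξ y : ℝ) (p : ℝ × ℝ) :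
    planeWave k ξ p * (testFun k ξ y).1 p = ((bump (p.2 - y) : ℝ) : ℂ) := by
  change exp (I * k * p.1) * exp (I * ξ * p.2) * (exp (I * (-k : ℤ) * p.1) *
    (exp (I * (-ξ : ℝ) * p.2) * ((bump (p.2 - y) : ℝ) : ℂ))) = _
  rw [← mul_assoc, ← mul_assoc, ← Complex.exp_add, ← Complex.exp_add, ← Complex.exp_add]
  have : I * k * p.1 + I * ξ * p.2 + I * (-k : ℤ) * p.1 + I * (-ξ : ℝ) * p.2 = 0 := by
    push_cast; ring
  rw [this, Complex.exp_zero, one_mul]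

/-- The oscillations cancel and only the translated bump is integrated. The value does not depend on
`y`: the pairing does not decay as the packet moves to infinity. -/
theorem planeDistr_testFun (k : ℤ) (ξ y : ℝ) :
    (planeDistr k ξ).1 (testFun k ξ y) = ((2 * Real.pi * ∫ x, bump x : ℝ) : ℂ) := by
  have hi := integrableOn_mul_schwartz (contDiff_planeWave k ξ).continuous
    (fun p => (norm_planeWave k ξ p).le) (testFun k ξ y)
  refine (integral_strip_eq hi).trans ?_
  simp only [planeWave_mul_testFun]
  rw [integral_const, integral_sub_right_eq_self (fun x => ((bump x : ℝ) : ℂ)) y,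
    integral_complex_ofReal]
  simp [Real.pi_pos.le]

/-- Against wave packets centred at `y = n → ∞`, a Schwartz function has pairings tending to `0` by
dominated convergence, while the plane wave keeps a fixed positive value. -/
theorem not_isSchwartz_planeDistr (k : ℤ) (ξ : ℝ) : ¬ IsSchwartz (planeDistr k ξ) := by
  rintro ⟨g, hg⟩
  have hpos : 0 < ∫ x, bump x := bump.integral_pos
  have hlim : Filter.Tendsto (fun n : ℕ => ∫ p in strip, g.1 p * (testFun k ξ n).1 p)
      Filter.atTop (nhds (∫ p in strip, (0 : ℂ))) := by
    refine tendsto_integral_of_dominated_convergence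
      (fun p => (semi 0 0 0 g.1 + semi 0 0 2 g.1) * (1 + p.2 ^ 2)⁻¹)
      (fun n => (g.2.1.continuous.mul (testFun k ξ n).2.1.continuous).aestronglyMeasurable)
      (integrableOn_strip_inv _) (fun n => ae_of_all _ fun p => ?_) (ae_of_all _ fun p => ?_)
    · rw [norm_mul, norm_testFun]
      exact (mul_le_of_le_one_right (norm_nonneg _) bump.le_one).trans (norm_le_semi_mul_inv g p)
    · refine tendsto_const_nhds.congr' ?_
      -- The bump has outer radius `2`, so the packet centred at `n ≥ x + 2` vanishes at `x`.
      obtain ⟨N, hN⟩ := exists_nat_ge (p.2 + 2)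
      filter_upwards [Filter.eventually_ge_atTop N] with n hn
      have hn' : (N : ℝ) ≤ n := by exact_mod_cast hn
      have h0 : (testFun k ξ n).1 p = 0 := by
        rw [← norm_eq_zero, norm_testFun]
        refine bump.zero_of_le_dist ?_
        rw [Real.dist_eq, sub_zero, abs_sub_comm]
        exact le_trans (by change (2 : ℝ) ≤ n - p.2; linarith) (le_abs_self _)
      rw [h0, mul_zero]
  simp only [← hg, planeDistr_testFun, integral_zero] at hlim
  have h := tendsto_nhds_unique hlim tendsto_const_nhds
  have h2 : 2 * Real.pi * ∫ x, bump x = 0 := by exact_mod_cast h.symm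
  have := Real.pi_pos
  exact (by positivity : 2 * Real.pi * ∫ x, bump x ≠ 0) h2

theorem not_globallyHypoelliptic_of_symbol_eq_zero {c₁ c₂ q : ℂ} {k : ℤ} {ξ : ℝ}
    (h : c₁ * (I * k) + c₂ * (I * ξ) + q = 0) : ¬ GloballyHypoelliptic (op c₁ c₂ q) := by
  intro hL
  refine not_isSchwartz_planeDistr k ξ (hL _ ⟨0, fun φ => ?_⟩)
  rw [op_planeDistr h]
  simp

/-! ### The two criteria and the theorem. -/

theorem globallyHypoelliptic_iff {c₁ c₂ q : ℂ} (hc : c₂ ≠ 0) :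
    GloballyHypoelliptic (op c₁ c₂ q) ↔ ∀ k : ℤ, ((c₁ * (I * k) + q) / c₂).re ≠ 0 := by
  constructor
  · intro h k hk
    -- The symbol vanishes when `iξ = -r_k`. If `Re r_k = 0` this has the real solution `ξ = -Im
    -- r_k`.
    refine not_globallyHypoelliptic_of_symbol_eq_zero (k := k)
      (ξ := -((c₁ * (I * k) + q) / c₂).im) ?_ h
    have h1 := Complex.re_add_im ((c₁ * (I * k) + q) / c₂)
    rw [hk] at h1
    have h2 : c₁ * (I * k) + q = c₂ * ((c₁ * (I * k) + q) / c₂) := by field_simp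
    rw [← h1] at h2
    push_cast at h2 ⊢
    linear_combination h2
  · intro h
    refine globallyHypoelliptic_of_surjective (surjective_op_of_re_ne_zero hc h)
      (surjective_op_of_re_ne_zero (neg_ne_zero.2 hc) fun k hk => h (-k) ?_)
    -- The ratio of the transpose at `k` is minus that of the operator at `-k`, so its real part
    -- never vanishes either.
    have : (c₁ * (I * (-k : ℤ)) + q) / c₂ = -((-c₁ * (I * k) + q) / -c₂) := by
      rw [div_neg, neg_neg]
      push_cast
      ring_nf
    rw [this, Complex.neg_re, hk, neg_zero]

/-- The symbol `ik + q` does not involve `ξ`. Its modulus is at least `|Re q|`, and at least the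
distance from `Im q` to the integers. -/
theorem globallyHypoelliptic_op_one_zero_iff {q : ℂ} :
    GloballyHypoelliptic (op 1 0 q) ↔ q.re ≠ 0 ∨ q.im ∉ Set.range ((↑) : ℤ → ℝ) := by
  constructor
  · intro h
    by_contra! hq
    obtain ⟨h0, k, hk⟩ := hq
    refine not_globallyHypoelliptic_of_symbol_eq_zero (k := -k) (ξ := 0) ?_ h
    refine Complex.ext ?_ ?_ <;> simp [h0, ← hk]
  · intro h
    obtain ⟨δ, hδ, hle⟩ : ∃ δ > 0, ∀ k : ℤ, δ ≤ ‖1 * (I * k) + q‖ := by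
      rcases h with h | h
      · refine ⟨|q.re|, abs_pos.2 h, fun k => ?_⟩
        simpa using Complex.abs_re_le_norm (1 * (I * k) + q)
      · obtain ⟨δ, hδ, hle⟩ := exists_pos_le_abs_affine (A := 1) (B := q.im) fun k hk =>
          h ⟨-k, by push_cast; linarith⟩
        refine ⟨δ, hδ, fun k => (hle k).trans ?_⟩
        simpa using Complex.abs_im_le_norm (1 * (I * k) + q)
    refine globallyHypoelliptic_of_surjective (surjective_op_of_norm_ge hδ hle) ?_
    rw [neg_zero]
    refine surjective_op_of_norm_ge hδ fun k => (hle (-k)).trans_eq ?_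
    push_cast
    congr 1
    ring

end CylinderSGH

end

theorem mainTheorem4 (a b : ℝ) (q : ℂ) :
    (CylinderSGH.GloballyHypoelliptic
        (CylinderSGH.dT + ((a : ℂ) + b * Complex.I) • CylinderSGH.dX + q • LinearMap.id) ↔
      (b ≠ 0 ∧ a * (q.re / b) + q.im ∉ Set.range ((↑) : ℤ → ℝ)) ∨
      (b = 0 ∧ q.re ≠ 0) ∨
      (a = 0 ∧ b = 0 ∧ q.re = 0 ∧ q.im ∉ Set.range ((↑) : ℤ → ℝ))) ∧
    (CylinderSGH.GloballyHypoelliptic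
        (((a : ℂ) + b * Complex.I) • CylinderSGH.dT + CylinderSGH.dX + q • LinearMap.id) ↔
      (b ≠ 0 ∧ q.re / b ∉ Set.range ((↑) : ℤ → ℝ)) ∨
      (b = 0 ∧ q.re ≠ 0)) := by
  have e1 : CylinderSGH.dT + ((a : ℂ) + b * Complex.I) • CylinderSGH.dX + q • LinearMap.id
      = CylinderSGH.op 1 ((a : ℂ) + b * Complex.I) q := by
    rw [CylinderSGH.op, one_smul]
  have e2 : ((a : ℂ) + b * Complex.I) • CylinderSGH.dT + CylinderSGH.dX + q • LinearMap.id
      = CylinderSGH.op ((a : ℂ) + b * Complex.I) 1 q := by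
    rw [CylinderSGH.op, one_smul]
  rw [e1, e2]
  constructor
  · by_cases hc : (a : ℂ) + b * Complex.I = 0
    · have ha : a = 0 := by simpa using congrArg Complex.re hc
      have hb : b = 0 := by simpa using congrArg Complex.im hc
      rw [hc, CylinderSGH.globallyHypoelliptic_op_one_zero_iff]
      simp only [ha, hb]
      tauto
    · have hn : Complex.normSq ((a : ℂ) + b * Complex.I) ≠ 0 := by simpa using hc
      -- Multiplying by `|a + ib|²` clears the denominator: the remaining numerator is the real part
      -- of `(ik + q)(a - ib)`.
      have hre : ∀ k : ℤ, ((1 * (Complex.I * k) + q) / ((a : ℂ) + b * Complex.I)).re ≠ 0 ↔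
          b * k + (a * q.re + b * q.im) ≠ 0 := fun k => by
        have : ((1 * (Complex.I * k) + q) / ((a : ℂ) + b * Complex.I)).re
            = (b * k + (a * q.re + b * q.im)) / Complex.normSq ((a : ℂ) + b * Complex.I) := by
          rw [Complex.div_re]
          simp
          ring
        rw [this, Ne, div_eq_zero_iff]
        tauto
      rw [CylinderSGH.globallyHypoelliptic_iff hc]
      simp only [hre]
      -- If `b = 0` then `a ≠ 0`, so the third alternative is void and the numerator is the constant
      -- `a Re q`.
      by_cases hb : b = 0
      · have ha : a ≠ 0 := by
          rintro rfl
          simp [hb] at hc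
        simp [hb, ha]
      · have hk : ∀ k : ℤ, b * k + (a * q.re + b * q.im) = 0 ↔
            ((-k : ℤ) : ℝ) = a * (q.re / b) + q.im := fun k => by
          push_cast
          constructor
          · intro h
            field_simp
            linarith
          · intro h
            field_simp at h
            linarith
        simp only [hb, Ne, hk, Set.mem_range, not_exists, not_false_eq_true, true_and, false_and,
          and_false, or_false]
        exact ⟨fun h k => by simpa using h (-k), fun h k => h (-k)⟩
  · rw [CylinderSGH.globallyHypoelliptic_iff one_ne_zero]
    have hre : ∀ k : ℤ,
        ((((a : ℂ) + b * Complex.I) * (Complex.I * k) + q) / 1).re = q.re - b * k := fun k => by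
      simp
      ring
    simp only [hre]
    by_cases hb : b = 0
    · simp [hb]
    · have hk : ∀ k : ℤ, q.re - b * k = 0 ↔ (k : ℝ) = q.re / b := fun k => by
        rw [eq_div_iff hb, sub_eq_zero, mul_comm, eq_comm]
      simp [hb, hk]
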